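/- **Notation.** Let $d\in\mathbb N$, and let $h_\alpha(x)=\pi^{-d/4}(-1)^{|\alpha|}(2^{|\alpha|}\alpha!)^{-1/2}e^{|x|^2/2}\partial^\alpha e^{-|x|^2}$, $\alpha\in\mathbb N^d$, be the Hermite functions on $\mathbb R^d$. Let $\mathcal H_0'(\mathbb R^d)$ be the space of all formal Hermite series $f=\sum_\alpha c_h(f,\alpha)h_\alpha$, and let $\mathcal H_{\flat_1}'(\mathbb R^d)$ be the subspace of those $f$ such that for every $r>0$ there is a $C$ with $|c_h(f,\alpha)|\le C r^{|\alpha|}(\alpha!)^{1/2}$ for all $\alpha$. * For $\varrho,c\in\mathbb C$ let $H_{x,\varrho,c}=\varrho(|x|^2-\Delta_x)+c$. Since $H_{x,\varrho,c}h_\alpha=(\varrho(2|\alpha|+d)+c)h_\alpha$, the operator $e^{\zeta H_{x,\varrho,c}}$, $\zeta\in\mathbb C$, is defined on $\mathcal H_0'(\mathbb R^d)$ by $\sum_\alpha c_h(f,\alpha)h_\alpha\mapsto\sum_\alpha e^{\zeta(\varrho(2|\alpha|+d)+c)}c_h(f,\alpha)h_\alpha$. * For $\varrho\in\mathbb R$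 the fractional Fourier transform $\mathscr F_\varrho$ is the operator with kernel $\prod_{j=1}^dK_\varrho(\xi_j,x_j)$, where $$K_\varrho(\xi,x)=\Big(\frac{1-i\cot(\frac{\pi\varrho}2)}{2\pi}\Big)^{1/2}\exp\Big(i\,\frac{(x^2+\xi^2)\cos(\frac{\pi\varrho}2)-2\xi x}{2\sin(\frac{\pi\varrho}2)}\Big)$$ (principal square root) if $\varrho\notin2\mathbb Z$, $K_\varrho(\xi,x)=\delta(\xi-x)$ if $\varrho\in4\mathbb Z$, and $K_\varrho(\xi,x)=\delta(\xi+x)$ if $\varrho\in2+4\mathbb Z$. It is extended from the Hermite functions to $\mathcal H_0'(\mathbb R^d)$ by linearity and continuity with respect to coefficientwise convergence. * Let $\phi(x)=\pi^{-d/4}e^{-|x|^2/2}$ and, for $f\in\mathcal H_{\flat_1}'(\mathbb R^d)$, let $V_\phi f(x,\xi)=(2\pi)^{-d/2}\big(f,\phi(\,\cdot\,-x)e^{i\langle\,\cdot\,,\xi\rangle}\big)$, where $(f,g)=\sum_\alpha c_h(f,\alpha)\overline{c_h(g,\alpha)}$. * A weight on $\mathbb R^{2d}$ is a positive function $\omega$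 with $\omega,1/\omega\in L^\infty_{\rm loc}(\mathbb R^{2d})$. For $p,q\in(0,\infty]$, the spaces $M^{p,q}_{(\omega)}(\mathbb R^d)$ and $W^{p,q}_{(\omega)}(\mathbb R^d)$ consist of all $f\in\mathcal H_{\flat_1}'(\mathbb R^d)$ for which $$\|f\|_{M^{p,q}_{(\omega)}}=\Big\|\xi\mapsto\|(V_\phi f\cdot\omega)(\,\cdot\,,\xi)\|_{L^p}\Big\|_{L^q},\qquad\text{respectively}\qquad\|f\|_{W^{p,q}_{(\omega)}}=\Big\|x\mapsto\|(V_\phi f\cdot\omega)(x,\,\cdot\,)\|_{L^q}\Big\|_{L^p},$$ is finite. Sums carry the quasi-norm $\inf\{\|g\|+\|h\|:f=g+h\}$ and intersections the maximum of the two quasi-norms. **Statement.** Let $\varrho\in\mathbb R$, $c\in\mathbb C$, let $p,q\in(0,\infty]$ with $q\le p$, and let $\omega,\omega_\varrho$ be weights on $\mathbb R^{2d}$ such that, with $\theta=\frac{\pi\varrho}2$, $$\omega_\varrho(x,\xi)=\omega\big((\cos\theta)x-(\sin\theta)\xi,\ (\sin\theta)x+(\cos\theta)\xi\big),\qquad x,\xi\in\mathbb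 R^d.$$ Then $e^{-i\frac\pi4H_{x,\varrho,c}}=e^{-i\frac\pi4(d\varrho+c)}\mathscr F_\varrho$ on $\mathcal H_0'(\mathbb R^d)$, and the following is true: 1. the maps $\mathscr F_\varrho$ and $e^{-i\frac\pi4H_{x,\varrho,c}}$ are continuous from $M^{p,q}_{(\omega)}(\mathbb R^d)+W^{q,p}_{(\omega)}(\mathbb R^d)$ to $M^{q,p}_{(\omega_\varrho)}(\mathbb R^d)+W^{p,q}_{(\omega_\varrho)}(\mathbb R^d)$; 2. if in addition $\varrho\notin\mathbb Z$, then $\mathscr F_\varrho$ and $e^{-i\frac\pi4H_{x,\varrho,c}}$ are continuous from $M^{p,q}_{(\omega)}(\mathbb R^d)+W^{q,p}_{(\omega)}(\mathbb R^d)$ to $M^{q,p}_{(\omega_\varrho)}(\mathbb R^d)\cap W^{p,q}_{(\omega_\varrho)}(\mathbb R^d)$. -/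

import Mathlib

open scoped ENNReal
open MeasureTheory

noncomputable section

namespace PilModulation

/-! ### Hermite functions and the harmonic oscillator

Points of `ℝ^d` are functions `Fin d → ℝ`; only the Lebesgue measure, the topology and the explicit
sums `∑ j, x j ^ 2`, `∑ j, x j * ξ j` are used on this space, never its (sup-)norm. -/

/-- The one-dimensional Hermite function
`h_n(t) = π^{-1/4} (-1)^n (2^n n!)^{-1/2} e^{t²/2} (d/dt)^n e^{-t²}`. -/
def hermiteFun (n : ℕ) (t : ℝ) : ℝ :=
  Real.pi ^ (-(1 / 4 : ℝ)) * (-1) ^ n * ((2 : ℝ) ^ n * (n.factorial : ℝ)) ^ (-(1 / 2 : ℝ)) *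
    (Real.exp (t ^ 2 / 2) * iteratedDeriv n (fun s : ℝ => Real.exp (-s ^ 2)) t)

/-- The Hermite function `h_α` on `ℝ^d`: since `∂^α e^{-|x|²} = ∏ j, ∂_j^{α_j} e^{-x_j²}`, the usual
formula `π^{-d/4} (-1)^{|α|} (2^{|α|} α!)^{-1/2} e^{|x|²/2} ∂^α e^{-|x|²}` is this product. -/
def hermite {d : ℕ} (α : Fin d → ℕ) (x : Fin d → ℝ) : ℝ :=
  ∏ j, hermiteFun (α j) (x j)

/-- The harmonic oscillator
`H_{x,ϱ,c} g = ϱ (|x|² g - Δ g) + c g = ϱ ∑ j, (x_j² g - ∂_j² g) + c g`. -/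
def harmonicOscillator {d : ℕ} (ϱ c : ℂ) (g : (Fin d → ℝ) → ℂ) (x : Fin d → ℝ) : ℂ :=
  ϱ * ∑ j, (((x j ^ 2 : ℝ) : ℂ) * g x -
    iteratedDeriv 2 (fun s : ℝ => g (Function.update x j s)) (x j)) + c * g x

/-- The eigenvalue `ϱ (2|α| + d) + c` of `H_{x,ϱ,c}` at `h_α`
(see `harmonicOscillator_hermite`). -/
def oscEigenvalue {d : ℕ} (ϱ c : ℂ) (α : Fin d → ℕ) : ℂ :=
  ϱ * (2 * ((∑ j, α j : ℕ) : ℂ) + (d : ℂ)) + c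

theorem gauss_contDiff : ContDiff ℝ (⊤ : ℕ∞) (fun s : ℝ => Real.exp (-s ^ 2)) := by
  fun_prop

theorem gauss_hasDerivAt (n : ℕ) (t : ℝ) :
    HasDerivAt (iteratedDeriv n (fun s : ℝ => Real.exp (-s ^ 2)))
      (iteratedDeriv (n + 1) (fun s : ℝ => Real.exp (-s ^ 2)) t) t := by
  rw [iteratedDeriv_succ]
  refine DifferentiableAt.hasDerivAt ?_
  exact (gauss_contDiff.differentiable_iteratedDeriv n
    (by exact_mod_cast WithTop.coe_lt_top n)).differentiableAt

theorem gauss_rec (n : ℕ) (t : ℝ) :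
    iteratedDeriv (n + 2) (fun s : ℝ => Real.exp (-s ^ 2)) t =
      -2 * t * iteratedDeriv (n + 1) (fun s : ℝ => Real.exp (-s ^ 2)) t -
        2 * (n + 1) * iteratedDeriv n (fun s : ℝ => Real.exp (-s ^ 2)) t := by
  have h1 : iteratedDeriv 1 (fun s : ℝ => Real.exp (-s ^ 2)) =
      fun t => -2 * t * iteratedDeriv 0 (fun s : ℝ => Real.exp (-s ^ 2)) t := by
    funext t
    rw [iteratedDeriv_one, iteratedDeriv_zero]
    have h : HasDerivAt (fun s : ℝ => Real.exp (-s ^ 2))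
        (Real.exp (-t ^ 2) * (-(2 * t))) t := by
      have := ((hasDerivAt_pow 2 t).neg).exp
      simpa using this
    rw [h.deriv]; ring
  induction n generalizing t with
  | zero =>
    rw [show 0 + 2 = 1 + 1 from rfl, iteratedDeriv_succ]
    have h2 := (((hasDerivAt_id t).const_mul (-2 : ℝ)).mul (gauss_hasDerivAt 0 t)).deriv
    rw [h1]
    simp only [id] at h2
    refine Eq.trans h2 ?_
    simp only [zero_add, h1]
    push_cast; ring
  | succ n ih =>
    rw [show n + 1 + 2 = (n + 2) + 1 from rfl, iteratedDeriv_succ]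
    have hf : iteratedDeriv (n + 2) (fun s : ℝ => Real.exp (-s ^ 2)) = _ := funext ih
    rw [hf]
    have h2 := ((((hasDerivAt_id t).const_mul (-2 : ℝ)).mul (gauss_hasDerivAt (n + 1) t)).sub
      ((gauss_hasDerivAt n t).const_mul (2 * ((n : ℝ) + 1)))).deriv
    simp only [id] at h2
    refine Eq.trans h2 ?_
    have h3 := ih t
    rw [show n + 1 + 1 = n + 2 from rfl]
    push_cast
    linear_combination (-2 * t) * h3

theorem hermiteFun_iteratedDeriv_two (n : ℕ) (t : ℝ) :
    iteratedDeriv 2 (hermiteFun n) t = (t ^ 2 - (2 * n + 1)) * hermiteFun n t := by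
  set g : ℕ → ℝ → ℝ := fun n => iteratedDeriv n (fun s : ℝ => Real.exp (-s ^ 2)) with hg
  set k : ℝ := Real.pi ^ (-(1 / 4 : ℝ)) * (-1) ^ n *
    ((2 : ℝ) ^ n * (n.factorial : ℝ)) ^ (-(1 / 2 : ℝ)) with hk
  have hh : hermiteFun n = fun t => k * (Real.exp (t ^ 2 / 2) * g n t) := rfl
  have he : ∀ t : ℝ, HasDerivAt (fun s : ℝ => Real.exp (s ^ 2 / 2))
      (Real.exp (t ^ 2 / 2) * t) t := by
    intro t
    have := ((hasDerivAt_pow 2 t).div_const 2).exp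
    simpa using this
  have hd : ∀ m t, HasDerivAt (g m) (g (m + 1) t) t := gauss_hasDerivAt
  have h1 : deriv (hermiteFun n) =
      fun t => k * (Real.exp (t ^ 2 / 2) * (t * g n t + g (n + 1) t)) := by
    funext t
    rw [hh]
    refine Eq.trans (((he t).mul (hd n t)).const_mul k).deriv ?_
    ring
  rw [show 2 = 1 + 1 from rfl, iteratedDeriv_succ, iteratedDeriv_one, h1]
  have h2 := (((he t).mul (((hasDerivAt_id t).mul (hd n t)).add (hd (n + 1) t))).const_mul k).deriv
  refine Eq.trans h2 ?_
  have hr : g (n + 2) t = -2 * t * g (n + 1) t - 2 * (n + 1) * g n t := gauss_rec n t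
  rw [hh, show n + 1 + 1 = n + 2 from rfl, hr]
  simp only [id, Pi.add_apply, Pi.mul_apply]
  ring

/-- `H_{x,ϱ,c} h_α = (ϱ (2|α| + d) + c) h_α`. -/
theorem harmonicOscillator_hermite {d : ℕ} (ϱ c : ℂ) (α : Fin d → ℕ) (x : Fin d → ℝ) :
    harmonicOscillator ϱ c (fun y => (hermite α y : ℂ)) x =
      oscEigenvalue ϱ c α * (hermite α x : ℂ) := by
  have key : ∀ j, iteratedDeriv 2
      (fun s : ℝ => ((hermite α (Function.update x j s) : ℝ) : ℂ)) (x j) =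
      (((x j ^ 2 - (2 * (α j : ℝ) + 1)) * hermite α x : ℝ) : ℂ) := by
    intro j
    have hu : (fun s : ℝ => ((hermite α (Function.update x j s) : ℝ) : ℂ)) =
        fun s : ℝ => (((∏ i ∈ Finset.univ.erase j, hermiteFun (α i) (x i)) *
          hermiteFun (α j) s : ℝ) : ℂ) := by
      funext s
      congr 1
      unfold hermite
      rw [← Finset.prod_erase_mul _ _ (Finset.mem_univ j)]
      congr 1
      · refine Finset.prod_congr rfl fun i hi => ?_
        rw [Function.update_of_ne (Finset.ne_of_mem_erase hi)]
      · rw [Function.update_self]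
    have hx : hermite α x = (∏ i ∈ Finset.univ.erase j, hermiteFun (α i) (x i)) *
        hermiteFun (α j) (x j) := by
      unfold hermite
      rw [← Finset.prod_erase_mul _ _ (Finset.mem_univ j)]
    have hc : ContDiff ℝ (⊤ : ℕ∞) (hermiteFun (α j)) := by
      unfold hermiteFun
      refine ContDiff.mul contDiff_const (ContDiff.mul (by fun_prop) ?_)
      rw [iteratedDeriv_eq_iterate]
      exact ContDiff.iterate_deriv (α j) gauss_contDiff
    have hd1 : ∀ t, HasDerivAt (hermiteFun (α j)) (deriv (hermiteFun (α j)) t) t := fun t =>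
      (hc.differentiable (by simp)).differentiableAt.hasDerivAt
    have hd2 : ∀ t, HasDerivAt (deriv (hermiteFun (α j)))
        (iteratedDeriv 2 (hermiteFun (α j)) t) t := fun t => by
      rw [show 2 = 1 + 1 from rfl, iteratedDeriv_succ, iteratedDeriv_one]
      have := (hc.differentiable_iteratedDeriv 1
        (by exact_mod_cast WithTop.coe_lt_top 1)).differentiableAt (x := t)
      rw [iteratedDeriv_one] at this
      exact this.hasDerivAt
    rw [hu, show 2 = 1 + 1 from rfl, iteratedDeriv_succ, iteratedDeriv_one]
    set k := ∏ i ∈ Finset.univ.erase j, hermiteFun (α i) (x i)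
    have e1 : deriv (fun s : ℝ => ((k * hermiteFun (α j) s : ℝ) : ℂ)) =
        fun s : ℝ => ((k * deriv (hermiteFun (α j)) s : ℝ) : ℂ) := by
      funext s
      exact (((hd1 s).const_mul k).ofReal_comp).deriv
    rw [e1, (((hd2 (x j)).const_mul k).ofReal_comp).deriv, hermiteFun_iteratedDeriv_two, hx]
    push_cast; ring
  unfold harmonicOscillator oscEigenvalue
  simp only [key]
  have hs : ∑ j, ((((x j ^ 2 : ℝ) : ℂ)) * (hermite α x : ℂ) -
      (((x j ^ 2 - (2 * (α j : ℝ) + 1)) * hermite α x : ℝ) : ℂ)) =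
      (2 * ((∑ j, α j : ℕ) : ℂ) + (d : ℂ)) * (hermite α x : ℂ) := by
    have : ∀ j, ((((x j ^ 2 : ℝ) : ℂ)) * (hermite α x : ℂ) -
      (((x j ^ 2 - (2 * (α j : ℝ) + 1)) * hermite α x : ℝ) : ℂ)) =
        (2 * (α j : ℂ) + 1) * (hermite α x : ℂ) := by
      intro j; push_cast; ring
    simp only [this, ← Finset.sum_mul, Finset.sum_add_distrib, ← Finset.mul_sum]
    push_cast; simp
  rw [hs]; ring

/-! ### Formal Hermite series and Pilipović distributions -/

/-- The space `𝓗₀'(ℝ^d)` of all formal Hermite series `∑ α, f(α) h_α`. A series is given by its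
family of coefficients, `f α` being the Hermite coefficient `c_h(f, α)`. -/
abbrev HermiteSeries (d : ℕ) : Type := (Fin d → ℕ) → ℂ

/-- The Hermite coefficient `c_h(g, α) = (g, h_α)_{L²}` of a function (`h_α` is real-valued). -/
def hermiteCoeff {d : ℕ} (g : (Fin d → ℝ) → ℂ) (α : Fin d → ℕ) : ℂ :=
  ∫ x, g x * (hermite α x : ℂ)

/-- The extension `(f, g) = ∑ α, c_h(f, α) conj (c_h(g, α))` of the `L²` scalar product. -/
def pairing {d : ℕ} (f : HermiteSeries d) (g : (Fin d → ℝ) → ℂ) : ℂ :=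
  ∑' α, f α * (starRingEnd ℂ) (hermiteCoeff g α)

/-- The Pilipović distribution space `𝓗'_{♭₁}(ℝ^d)`: for every `r > 0`,
`|f(α)| ≤ C r^{|α|} (α!)^{1/2}` for some `C`. -/
def pilipovicDual (d : ℕ) : Set (HermiteSeries d) :=
  {f | ∀ r : ℝ, 0 < r → ∃ C : ℝ, ∀ α : Fin d → ℕ,
    ‖f α‖ ≤ C * r ^ (∑ j, α j) * Real.sqrt ((∏ j, (α j).factorial : ℕ) : ℝ)}

/-! ### Propagators and fractional Fourier transforms -/

/-- The operator `e^{ζ H_{x,ϱ,c}}` on formal Hermite series,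
`∑ α, f(α) h_α ↦ ∑ α, e^{ζ (ϱ (2|α| + d) + c)} f(α) h_α`. -/
def oscPropagator {d : ℕ} (ζ ϱ c : ℂ) (f : HermiteSeries d) : HermiteSeries d :=
  fun α => Complex.exp (ζ * oscEigenvalue ϱ c α) * f α

/-- The one-dimensional kernel `K_ϱ(ξ, x)` of the fractional Fourier transform for `ϱ ∉ 2ℤ`, with
the principal branch of the square root. -/
def fracKernel (ϱ ξ x : ℝ) : ℂ :=
  ((1 - Complex.I * (Real.cot (Real.pi * ϱ / 2) : ℂ)) / (2 * (Real.pi : ℂ))) ^ (1 / 2 : ℂ) *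
    Complex.exp (Complex.I *
      ((((x ^ 2 + ξ ^ 2) * Real.cos (Real.pi * ϱ / 2) - 2 * ξ * x) /
        (2 * Real.sin (Real.pi * ϱ / 2)) : ℝ) : ℂ))

open Classical in
/-- The fractional Fourier transform of order `ϱ ∈ ℝ` on functions: the operator with kernel
`∏ j, K_ϱ(ξ_j, x_j)`, where `K_ϱ(ξ, x)` is `δ(ξ - x)` if `ϱ ∈ 4ℤ` and `δ(ξ + x)` if
`ϱ ∈ 2 + 4ℤ`. -/
def fracFourierFun {d : ℕ} (ϱ : ℝ) (g : (Fin d → ℝ) → ℂ) (ξ : Fin d → ℝ) : ℂ :=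
  if ∃ k : ℤ, ϱ = 4 * k then g ξ
  else if ∃ k : ℤ, ϱ = 2 + 4 * k then g (-ξ)
  else ∫ x, (∏ j, fracKernel ϱ (ξ j) (x j)) * g x

/-- The fractional Fourier transform on formal Hermite series, i.e. the linear extension
`∑ β, f(β) h_β ↦ ∑ β, f(β) 𝓕_ϱ h_β`, continuous for coefficientwise convergence; its coefficient
at `α` is `∑ β, f(β) c_h(𝓕_ϱ h_β, α)`. -/
def fracFourier {d : ℕ} (ϱ : ℝ) (f : HermiteSeries d) : HermiteSeries d :=
  fun α => ∑' β, f β * hermiteCoeff (fracFourierFun ϱ (fun x => (hermite β x : ℂ))) α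

/-! ### Short-time Fourier transform, weights, modulation and Wiener amalgam spaces -/

/-- The Gaussian window `φ(x) = π^{-d/4} e^{-|x|²/2}`. -/
def gaussWindow {d : ℕ} (x : Fin d → ℝ) : ℝ :=
  Real.pi ^ (-((d : ℝ) / 4)) * Real.exp (-(∑ j, x j ^ 2) / 2)

/-- The short-time Fourier transform
`V_φ f(x, ξ) = (2π)^{-d/2} (f, φ(· - x) e^{i⟨·, ξ⟩})` with the Gaussian window. -/
def stft {d : ℕ} (f : HermiteSeries d) (z : (Fin d → ℝ) × (Fin d → ℝ)) : ℂ :=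
  (((2 * Real.pi) ^ (-((d : ℝ) / 2)) : ℝ) : ℂ) *
    pairing f (fun y => (gaussWindow (y - z.1) : ℂ) *
      Complex.exp (Complex.I * ((∑ j, y j * z.2 j : ℝ) : ℂ)))

/-- Weights on `ℝ^{2d}`: positive functions `ω` with `ω, 1/ω ∈ L^∞_loc`. -/
structure IsWeight {d : ℕ} (ω : (Fin d → ℝ) × (Fin d → ℝ) → ℝ) : Prop where
  pos : ∀ z, 0 < ω z
  memLp : ∀ K, IsCompact K → MemLp ω ∞ (volume.restrict K)
  memLp_inv : ∀ K, IsCompact K → MemLp (fun z => (ω z)⁻¹) ∞ (volume.restrict K)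

/-- The mixed quasi-norm `‖G‖_{L^{p,q}}`: `L^p` in `x`, then `L^q` in `ξ`. -/
def mixedNorm {d : ℕ} (p q : ℝ≥0∞) (G : (Fin d → ℝ) × (Fin d → ℝ) → ℂ) : ℝ≥0∞ :=
  eLpNorm (fun ξ : Fin d → ℝ => eLpNorm (fun x : Fin d → ℝ => G (x, ξ)) p volume) q volume

/-- The mixed quasi-norm `‖G‖_{L^{p,q}_*}`: `L^q` in `ξ`, then `L^p` in `x`. -/
def mixedNormStar {d : ℕ} (p q : ℝ≥0∞) (G : (Fin d → ℝ) × (Fin d → ℝ) → ℂ) : ℝ≥0∞ :=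
  eLpNorm (fun x : Fin d → ℝ => eLpNorm (fun ξ : Fin d → ℝ => G (x, ξ)) q volume) p volume

/-- A set of formal Hermite series together with a `[0, ∞]`-valued gauge. It is only used as a
container for the concrete (quasi-)normed spaces below. -/
structure GaugedSpace (d : ℕ) where
  carrier : Set (HermiteSeries d)
  gauge : HermiteSeries d → ℝ≥0∞

/-- The modulation space `M^{p,q}_{(ω)}(ℝ^d)`. -/
def modulationSpace {d : ℕ} (p q : ℝ≥0∞) (ω : (Fin d → ℝ) × (Fin d → ℝ) → ℝ) : GaugedSpace d where
  carrier := {f | f ∈ pilipovicDual d ∧ mixedNorm p q (fun z => stft f z * (ω z : ℂ)) < ∞}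
  gauge f := mixedNorm p q (fun z => stft f z * (ω z : ℂ))

/-- The Wiener amalgam space `W^{p,q}_{(ω)}(ℝ^d)`. -/
def amalgamSpace {d : ℕ} (p q : ℝ≥0∞) (ω : (Fin d → ℝ) × (Fin d → ℝ) → ℝ) : GaugedSpace d where
  carrier := {f | f ∈ pilipovicDual d ∧ mixedNormStar p q (fun z => stft f z * (ω z : ℂ)) < ∞}
  gauge f := mixedNormStar p q (fun z => stft f z * (ω z : ℂ))

/-- The sum `X + Y`, with `‖f‖ = inf {‖g‖_X + ‖h‖_Y : g ∈ X, h ∈ Y, g + h = f}`. -/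
def GaugedSpace.sum {d : ℕ} (X Y : GaugedSpace d) : GaugedSpace d where
  carrier := {f | ∃ g ∈ X.carrier, ∃ h ∈ Y.carrier, g + h = f}
  gauge f := ⨅ (g ∈ X.carrier) (h ∈ Y.carrier) (_ : g + h = f), X.gauge g + Y.gauge h

/-- The intersection `X ∩ Y`, with `‖f‖ = max (‖f‖_X, ‖f‖_Y)`. -/
def GaugedSpace.inter {d : ℕ} (X Y : GaugedSpace d) : GaugedSpace d where
  carrier := X.carrier ∩ Y.carrier
  gauge f := max (X.gauge f) (Y.gauge f)

/-- The topology given by the quasi-norm: `U` is open if around each of its points `f` it contains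
some ball `{g : ‖g - f‖ < ε}`. -/
@[reducible] def GaugedSpace.topology {d : ℕ} (X : GaugedSpace d) : TopologicalSpace X.carrier where
  IsOpen U := ∀ f ∈ U, ∃ ε : ℝ≥0∞, 0 < ε ∧
    ∀ g : X.carrier, X.gauge ((g : HermiteSeries d) - (f : HermiteSeries d)) < ε → g ∈ U
  isOpen_univ := fun _ _ => ⟨1, one_pos, fun _ _ => Set.mem_univ _⟩
  isOpen_inter := fun U V hU hV f hf => by
    obtain ⟨ε, hε, h⟩ := hU f hf.1
    obtain ⟨δ, hδ, k⟩ := hV f hf.2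
    exact ⟨min ε δ, lt_min hε hδ, fun g hg =>
      ⟨h g (hg.trans_le (min_le_left _ _)), k g (hg.trans_le (min_le_right _ _))⟩⟩
  isOpen_sUnion := fun s hs f ⟨U, hU, hf⟩ => by
    obtain ⟨ε, hε, h⟩ := hs U hU f hf
    exact ⟨ε, hε, fun g hg => ⟨U, hU, h g hg⟩⟩

/-- `T` maps `X` into `Y`, and is continuous from `X` to `Y`. -/
def MapsContinuously {d : ℕ} (T : HermiteSeries d → HermiteSeries d) (X Y : GaugedSpace d) : Prop :=
  ∃ h : Set.MapsTo T X.carrier Y.carrier,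
    @Continuous X.carrier Y.carrier X.topology Y.topology (h.restrict T X.carrier Y.carrier)

/-- The rotation of phase space which describes `𝓕_ϱ`: with `θ = πϱ/2`,
`(x, ξ) ↦ ((cos θ) x - (sin θ) ξ, (sin θ) x + (cos θ) ξ)`. -/
def phaseRotation {d : ℕ} (ϱ : ℝ) (z : (Fin d → ℝ) × (Fin d → ℝ)) :
    (Fin d → ℝ) × (Fin d → ℝ) :=
  (Real.cos (Real.pi * ϱ / 2) • z.1 - Real.sin (Real.pi * ϱ / 2) • z.2,
    Real.sin (Real.pi * ϱ / 2) • z.1 + Real.cos (Real.pi * ϱ / 2) • z.2)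

end PilModulation

end

open PilModulation

/-! Everything is read off from the Hermite expansion. Each `h_α` is an eigenfunction of `𝓕_ϱ` with
eigenvalue `e^{-iθ|α|}`, `θ = πϱ/2` (`fracFourierFun_hermite`), so on formal series `𝓕_ϱ` is a
coefficient multiplier. Comparing multipliers gives the identity with the propagator.

The short-time Fourier transform with Gaussian window sends `h_α` to a fixed Gaussian factor, of
modulus radial in `(x, ξ)`, times a monomial of degree `|α|` in the variables `x_j - iξ_j`
(`stft_eq`). The phase rotation multiplies each `x_j - iξ_j` by `e^{-iθ}`. Hence `|V_φ(𝓕_ϱ f)|` is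
`|V_φ f|` composed with the rotation (`norm_stft_smul_fracFourier`), and the relation between the
weights extends this to the weighted transforms.

What remains concerns mixed norms only (`mixedENorm_comp_blockMap_le`): for `q ≤ p`, composition
with an invertible block matrix maps `L^{p,q}` to `L^{q,p}` as soon as its lower left entry is
nonzero. The proof is a linear substitution, Minkowski's inequality and a second substitution. For
the rotation that entry is `± sin θ` for `M → M` and `W → W`, and `cos θ` for `M → W` and `W → M`.
The two never vanish together, which gives the sum as target; both are nonzero when `ϱ ∉ ℤ`, which
gives the intersection. -/

namespace PilModulation

/-! ### Hermite polynomials, Gaussian integrals and the fractional Fourier kernel. -/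

section GaussianMoments

open Polynomial

/-- The polynomials `P_n` with `(d/dt)^n e^{-t²} = P_n(t) e^{-t²}`. -/
noncomputable def gaussPoly : ℕ → ℝ[X]
  | 0 => 1
  | n + 1 => derivative (gaussPoly n) - C 2 * X * gaussPoly n

theorem iteratedDeriv_gauss (n : ℕ) (t : ℝ) :
    iteratedDeriv n (fun s : ℝ => Real.exp (-s ^ 2)) t =
      (gaussPoly n).eval t * Real.exp (-t ^ 2) := by
  induction n generalizing t with
  | zero => simp [gaussPoly]
  | succ n ih =>
    rw [iteratedDeriv_succ, funext ih]
    have h : HasDerivAt (fun s : ℝ => Real.exp (-s ^ 2)) (Real.exp (-t ^ 2) * (-(2 * t))) t := by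
      simpa using ((hasDerivAt_pow 2 t).neg).exp
    refine (((gaussPoly n).hasDerivAt t).mul h).deriv.trans ?_
    simp only [gaussPoly, eval_sub, eval_mul, eval_C, eval_X]
    ring

/-- The lowering relation. Together with the defining (raising) recursion it yields the three-term
recurrence, and it turns the derivatives produced by integration by parts into polynomials of lower
index. -/
theorem derivative_gaussPoly_succ (n : ℕ) :
    derivative (gaussPoly (n + 1)) = -(C (2 * ((n : ℝ) + 1)) * gaussPoly n) := by
  induction n with
  | zero => simp [gaussPoly]
  | succ n ih =>
    rw [gaussPoly, derivative_sub, ih]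
    have h : gaussPoly (n + 1) = derivative (gaussPoly n) - C 2 * X * gaussPoly n := rfl
    simp only [derivative_neg, derivative_mul, derivative_C, derivative_X, ih, zero_mul, zero_add,
      mul_one]
    push_cast
    simp only [C_mul, C_add, C_1]
    linear_combination (C 2 * (C (n : ℝ) + 1)) * h

theorem gaussPoly_eval_succ_succ (n : ℕ) (x : ℝ) :
    (gaussPoly (n + 2)).eval x =
      -2 * x * (gaussPoly (n + 1)).eval x - 2 * (n + 1) * (gaussPoly n).eval x := by
  rw [gaussPoly, derivative_gaussPoly_succ]
  simp only [eval_sub, eval_neg, eval_mul, eval_C, eval_X]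
  ring

theorem gaussPoly_eval_neg (n : ℕ) (x : ℝ) :
    (gaussPoly n).eval (-x) = (-1) ^ n * (gaussPoly n).eval x := by
  induction n using Nat.strong_induction_on with
  | _ n ih =>
    match n with
    | 0 => simp [gaussPoly]
    | 1 => simp [gaussPoly]
    | n + 2 =>
      rw [gaussPoly_eval_succ_succ, gaussPoly_eval_succ_succ, ih n (by omega),
        ih (n + 1) (by omega)]
      ring

/-- The normalising constant of the Hermite function of degree `n`. -/
noncomputable def hermConst (n : ℕ) : ℝ :=
  Real.pi ^ (-(1 / 4 : ℝ)) * (-1) ^ n * ((2 : ℝ) ^ n * (n.factorial : ℝ)) ^ (-(1 / 2 : ℝ))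

theorem hermiteFun_eq (n : ℕ) (t : ℝ) :
    hermiteFun n t = hermConst n * ((gaussPoly n).eval t * Real.exp (-t ^ 2 / 2)) := by
  have h : Real.exp (t ^ 2 / 2) * Real.exp (-t ^ 2) = Real.exp (-t ^ 2 / 2) := by
    rw [← Real.exp_add]; ring_nf
  rw [hermiteFun, iteratedDeriv_gauss, hermConst, ← h]
  ring

theorem hermiteFun_neg (n : ℕ) (t : ℝ) : hermiteFun n (-t) = (-1) ^ n * hermiteFun n t := by
  rw [hermiteFun_eq, hermiteFun_eq, gaussPoly_eval_neg, neg_sq]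
  ring

theorem hermConst_sq (n : ℕ) :
    hermConst n ^ 2 * (Real.sqrt Real.pi * (2 ^ n * n.factorial)) = 1 := by
  have h1 : (0 : ℝ) < 2 ^ n * n.factorial := by positivity
  have h2 : (((2 : ℝ) ^ n * (n.factorial : ℝ)) ^ (-(1 / 2 : ℝ))) ^ 2 =
      (2 ^ n * (n.factorial : ℝ))⁻¹ := by
    rw [← Real.rpow_natCast, ← Real.rpow_mul h1.le, ← Real.rpow_neg_one]; norm_num
  have h3 : (Real.pi ^ (-(1 / 4 : ℝ))) ^ 2 = (Real.sqrt Real.pi)⁻¹ := by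
    rw [← Real.rpow_natCast, ← Real.rpow_mul Real.pi_pos.le, Real.sqrt_eq_rpow,
      ← Real.rpow_neg Real.pi_pos.le]; norm_num
  have h4 : Real.sqrt Real.pi ≠ 0 := (Real.sqrt_pos.2 Real.pi_pos).ne'
  rw [hermConst, mul_pow, mul_pow, h2, h3, ← pow_mul, mul_comm n 2, pow_mul, neg_one_sq, one_pow]
  field_simp

theorem integrable_poly_mul_cexp (P : ℝ[X]) {b : ℂ} (hb : b.re < 0) (c d : ℂ) :
    Integrable (fun x : ℝ => ((P.eval x : ℝ) : ℂ) * Complex.exp (b * x ^ 2 + c * x + d)) := by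
  induction P using Polynomial.induction_on' with
  | add p q hp hq =>
    refine (hp.add hq).congr (Filter.Eventually.of_forall fun x => ?_)
    simp only [Pi.add_apply, eval_add, Complex.ofReal_add]
    ring
  | monomial n a =>
    -- Since `|x|^n ≤ n! (e^x + e^{-x})`, the monomial is absorbed by shifting the linear
    -- coefficient `c` by `±1`.
    have h1 := ((integrable_cexp_quadratic' hb (c + 1) d).norm.add
      (integrable_cexp_quadratic' hb (c - 1) d).norm).const_mul (|a| * n.factorial)
    refine h1.mono' (by fun_prop) (Filter.Eventually.of_forall fun x => ?_)
    have h2 : |x| ^ n ≤ n.factorial * (Real.exp x + Real.exp (-x)) := by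
      have h3 := Real.pow_div_factorial_le_exp |x| (abs_nonneg x) n
      rw [div_le_iff₀ (by positivity), mul_comm] at h3
      refine h3.trans (mul_le_mul_of_nonneg_left ?_ (by positivity))
      rcases abs_cases x with h | h <;> rw [h.1] <;>
        linarith [Real.exp_pos x, Real.exp_pos (-x)]
    have e1 : Complex.exp (b * x ^ 2 + (c + 1) * x + d) =
        (Real.exp x : ℂ) * Complex.exp (b * x ^ 2 + c * x + d) := by
      rw [Complex.ofReal_exp, ← Complex.exp_add]; ring_nf
    have e2 : Complex.exp (b * x ^ 2 + (c - 1) * x + d) =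
        (Real.exp (-x) : ℂ) * Complex.exp (b * x ^ 2 + c * x + d) := by
      rw [Complex.ofReal_exp, ← Complex.exp_add]; push_cast; ring_nf
    simp only [Pi.add_apply, e1, e2, norm_mul, eval_monomial, Complex.norm_real, Real.norm_eq_abs,
      abs_pow, Real.abs_exp]
    calc |a| * |x| ^ n * ‖Complex.exp (b * x ^ 2 + c * x + d)‖
        ≤ |a| * (n.factorial * (Real.exp x + Real.exp (-x))) *
          ‖Complex.exp (b * x ^ 2 + c * x + d)‖ := by gcongr
      _ = _ := by ring

/-- The integral of a polynomial against a complex Gaussian. -/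
noncomputable def gaussInt (b c d : ℂ) (P : ℝ[X]) : ℂ :=
  ∫ x : ℝ, ((P.eval x : ℝ) : ℂ) * Complex.exp (b * x ^ 2 + c * x + d)

theorem gaussInt_add {b : ℂ} (hb : b.re < 0) (c d : ℂ) (P Q : ℝ[X]) :
    gaussInt b c d (P + Q) = gaussInt b c d P + gaussInt b c d Q := by
  unfold gaussInt
  rw [← integral_add (integrable_poly_mul_cexp P hb c d) (integrable_poly_mul_cexp Q hb c d)]
  simp [add_mul]

theorem gaussInt_C_mul (b c d : ℂ) (r : ℝ) (P : ℝ[X]) :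
    gaussInt b c d (C r * P) = r * gaussInt b c d P := by
  unfold gaussInt
  rw [← integral_const_mul]
  simp [mul_assoc]

theorem gaussInt_neg (b c d : ℂ) (P : ℝ[X]) : gaussInt b c d (-P) = -gaussInt b c d P := by
  simpa using gaussInt_C_mul b c d (-1) P

theorem gaussInt_sub {b : ℂ} (hb : b.re < 0) (c d : ℂ) (P Q : ℝ[X]) :
    gaussInt b c d (P - Q) = gaussInt b c d P - gaussInt b c d Q := by
  rw [sub_eq_add_neg, gaussInt_add hb, gaussInt_neg, sub_eq_add_neg]

theorem gaussInt_one {b : ℂ} (hb : b.re < 0) (c d : ℂ) :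
    gaussInt b c d 1 = (Real.pi / -b) ^ (1 / 2 : ℂ) * Complex.exp (d - c ^ 2 / (4 * b)) := by
  simpa [gaussInt] using integral_cexp_quadratic hb c d

/-- Integration by parts against a complex Gaussian. -/
theorem gaussInt_derivative {b : ℂ} (hb : b.re < 0) (c d : ℂ) (P : ℝ[X]) :
    gaussInt b c d (derivative P) + 2 * b * gaussInt b c d (X * P) + c * gaussInt b c d P = 0 := by
  have i1 := integrable_poly_mul_cexp (derivative P) hb c d
  have i2 := (integrable_poly_mul_cexp (X * P) hb c d).const_mul (2 * b)
  have i3 := (integrable_poly_mul_cexp P hb c d).const_mul c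
  unfold gaussInt
  have h := integral_add (i1.add i2) i3
  simp only [Pi.add_apply] at h
  rw [← integral_const_mul, ← integral_const_mul, ← integral_add i1 i2, ← h]
  refine integral_eq_zero_of_hasDerivAt_of_integrable
    (f := fun x : ℝ => ((P.eval x : ℝ) : ℂ) * Complex.exp (b * x ^ 2 + c * x + d)) (fun x => ?_)
    ((i1.add i2).add i3) (integrable_poly_mul_cexp P hb c d)
  have hx : HasDerivAt (fun x : ℝ => (x : ℂ)) 1 x := Complex.ofRealCLM.hasDerivAt
  have h1 := (((hx.pow 2).const_mul b).add (hx.const_mul c)).add_const d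
  convert! (P.hasDerivAt x).ofReal_comp.mul h1.cexp using 1
  simp only [eval_mul, eval_X, Complex.ofReal_mul, Pi.add_apply, Pi.pow_apply]
  push_cast
  ring

theorem gaussInt_X_mul_two {b : ℂ} (hb : b.re < 0) (c d : ℂ) (n : ℕ) (P : ℝ[X]) :
    2 * gaussInt b c d (X * (P * gaussPoly n)) =
      gaussInt b c d (P * derivative (gaussPoly n)) - gaussInt b c d (P * gaussPoly (n + 1)) := by
  rw [← gaussInt_sub hb, ← Complex.ofReal_ofNat, ← gaussInt_C_mul]
  congr 1
  rw [gaussPoly]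
  ring

/-- Integration by parts, with `X * gaussPoly n` eliminated through the raising recursion. For `b =
-1` the derivative term drops out and the integrals are geometric in `n`; for general `b` a
three-term recurrence remains. -/
theorem gaussInt_gaussPoly_succ {b : ℂ} (hb : b.re < 0) (c d : ℂ) (n : ℕ) :
    b * gaussInt b c d (gaussPoly (n + 1)) =
      (1 + b) * gaussInt b c d (derivative (gaussPoly n)) + c * gaussInt b c d (gaussPoly n) := by
  have h1 := gaussInt_derivative hb c d (gaussPoly n)
  have h2 := gaussInt_X_mul_two hb c d n 1
  simp only [one_mul] at h2
  linear_combination b * h2 - h1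

/-- The two-sided Laplace transform of the derivatives of the Gaussian. -/
theorem gaussInt_neg_one_gaussPoly (c d : ℂ) (n : ℕ) :
    gaussInt (-1) c d (gaussPoly n) =
      (-c) ^ n * (Real.sqrt Real.pi * Complex.exp (d + c ^ 2 / 4)) := by
  have hb : (-1 : ℂ).re < 0 := by simp
  induction n with
  | zero =>
    rw [gaussPoly, gaussInt_one hb, Real.sqrt_eq_rpow, Complex.ofReal_cpow Real.pi_pos.le]
    norm_num
    ring_nf
  | succ n ih =>
    have := gaussInt_gaussPoly_succ hb c d n
    rw [ih] at this
    rw [pow_succ]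
    linear_combination -this

/-- Integration by parts moves one derivative from the second factor to the first, lowering both
indices by one. At `n = 0` the Laplace transform at `c = 0` leaves `0 ^ m`. -/
theorem gaussInt_mul_gaussPoly (m n : ℕ) :
    gaussInt (-1) 0 0 (gaussPoly m * gaussPoly n) =
      if m = n then (Real.sqrt Real.pi * (2 ^ n * n.factorial) : ℂ) else 0 := by
  have hb : (-1 : ℂ).re < 0 := by simp
  induction n generalizing m with
  | zero =>
    have h0 : gaussPoly 0 = 1 := rfl
    rw [h0, mul_one, gaussInt_neg_one_gaussPoly]
    cases m <;> simp
  | succ n ih =>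
    have h1 := gaussInt_derivative hb 0 0 (gaussPoly m * gaussPoly n)
    have h2 := gaussInt_X_mul_two hb 0 0 n (gaussPoly m)
    rw [derivative_mul, gaussInt_add hb] at h1
    have h3 : gaussInt (-1) 0 0 (gaussPoly m * gaussPoly (n + 1)) =
        -gaussInt (-1) 0 0 (derivative (gaussPoly m) * gaussPoly n) := by
      linear_combination h1 + h2
    rw [h3]
    cases m with
    | zero => simp [gaussPoly, gaussInt]
    | succ m =>
      rw [derivative_gaussPoly_succ, neg_mul, gaussInt_neg, neg_neg, mul_assoc, gaussInt_C_mul, ih]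
      by_cases h : m = n
      · subst h
        simp only [if_true, Nat.factorial_succ]
        push_cast
        ring
      · simp [h]

/-- Orthonormality of the Hermite functions. -/
theorem integral_hermiteFun_mul (m n : ℕ) :
    ∫ x : ℝ, (hermiteFun m x : ℂ) * (hermiteFun n x : ℂ) = if m = n then 1 else 0 := by
  have h : ∀ x : ℝ, (hermiteFun m x : ℂ) * (hermiteFun n x : ℂ) =
      (hermConst m * hermConst n : ℂ) *
        ((((gaussPoly m * gaussPoly n).eval x : ℝ) : ℂ) *
          Complex.exp ((-1) * x ^ 2 + 0 * x + 0)) := by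
    intro x
    have e : Complex.exp ((-1) * x ^ 2 + 0 * x + 0) =
        Complex.exp (-x ^ 2 / 2) * Complex.exp (-x ^ 2 / 2) := by
      rw [← Complex.exp_add]; ring_nf
    rw [hermiteFun_eq, hermiteFun_eq, e, eval_mul]
    push_cast
    ring
  simp_rw [h]
  rw [integral_const_mul]
  have := gaussInt_mul_gaussPoly m n
  unfold gaussInt at this
  rw [this]
  by_cases hmn : m = n
  · subst hmn
    simp only [if_true]
    rw [← sq]
    exact_mod_cast hermConst_sq m
  · simp [hmn]

/-- The chirp of the kernel merges with `e^{-x²/2}` into one complex Gaussian whose quadratic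
coefficient has real part `-1/2`, so the integrals against it converge absolutely. -/
theorem fracKernel_mul_hermiteFun (ϱ ξ x : ℝ) (n : ℕ) :
    fracKernel ϱ ξ x * (hermiteFun n x : ℂ) =
      (((1 - Complex.I * (Real.cot (Real.pi * ϱ / 2) : ℂ)) / (2 * (Real.pi : ℂ))) ^ (1 / 2 : ℂ) *
        hermConst n) * ((((gaussPoly n).eval x : ℝ) : ℂ) *
          Complex.exp (-(1 - Complex.I * (Real.cot (Real.pi * ϱ / 2) : ℂ)) / 2 * x ^ 2 +
            -(Complex.I * ξ / Real.sin (Real.pi * ϱ / 2)) * x +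
            Complex.I * ξ ^ 2 * (Real.cot (Real.pi * ϱ / 2) : ℂ) / 2)) := by
  have e : Complex.exp (-(1 - Complex.I * (Real.cot (Real.pi * ϱ / 2) : ℂ)) / 2 * x ^ 2 +
            -(Complex.I * ξ / Real.sin (Real.pi * ϱ / 2)) * x +
            Complex.I * ξ ^ 2 * (Real.cot (Real.pi * ϱ / 2) : ℂ) / 2) =
      Complex.exp (Complex.I *
      ((((x ^ 2 + ξ ^ 2) * Real.cos (Real.pi * ϱ / 2) - 2 * ξ * x) /
        (2 * Real.sin (Real.pi * ϱ / 2)) : ℝ) : ℂ)) * Complex.exp (-x ^ 2 / 2) := by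
    rw [← Complex.exp_add, Real.cot_eq_cos_div_sin]
    congr 1
    simp only [Complex.ofReal_mul, Complex.ofReal_sub, Complex.ofReal_add,
      Complex.ofReal_pow, Complex.ofReal_ofNat, Complex.ofReal_inv, div_eq_mul_inv, mul_inv]
    ring
  rw [e, fracKernel, hermiteFun_eq]
  push_cast
  ring

/-- With `z = 1 - i cot θ` and `v = e^{-iθ}` one has `z v sin θ = -i`. The recurrence for the
Gaussian integrals then has coefficients `v²` and `-2ξv`, so `v^n P_n(ξ)` times the integral for `n
= 0` solves it, by the three-term recurrence of `P_n`. The normalising root of the kernel cancels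
the constant of that first integral. -/
theorem integral_fracKernel_mul_hermiteFun {ϱ : ℝ} (hs : Real.sin (Real.pi * ϱ / 2) ≠ 0) (ξ : ℝ)
    (n : ℕ) :
    ∫ x : ℝ, fracKernel ϱ ξ x * (hermiteFun n x : ℂ) =
      Complex.exp (-(Complex.I * (Real.pi * ϱ / 2 : ℝ))) ^ n * (hermiteFun n ξ : ℂ) := by
  set θ : ℝ := Real.pi * ϱ / 2 with hθ
  set v : ℂ := Complex.exp (-(Complex.I * (θ : ℝ))) with hv
  have hs' : (Real.sin θ : ℂ) ≠ 0 := by exact_mod_cast hs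
  have hv1 : v = Real.cos θ - Complex.I * Real.sin θ := by
    rw [hv, mul_comm, ← neg_mul, Complex.exp_mul_I, Complex.cos_neg, Complex.sin_neg]
    push_cast; ring
  have hcs : (Real.cos θ : ℂ) ^ 2 + (Real.sin θ : ℂ) ^ 2 = 1 := by
    exact_mod_cast Real.cos_sq_add_sin_sq θ
  have hv0 : v ≠ 0 := Complex.exp_ne_zero _
  set z : ℂ := 1 - Complex.I * (Real.cot θ : ℂ) with hz
  set c : ℂ := -(Complex.I * ξ / Real.sin θ) with hc
  set e : ℂ := Complex.I * ξ ^ 2 * (Real.cot θ : ℂ) / 2 with he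
  have hzv : z * v * Real.sin θ = -Complex.I := by
    have : (Real.cot θ : ℂ) = Real.cos θ / Real.sin θ := by
      rw [Real.cot_eq_cos_div_sin]; push_cast; rfl
    rw [hz, hv1, this]
    field_simp
    linear_combination -Complex.I * hcs + (Real.cos θ * Real.sin θ : ℂ) * Complex.I_sq
  have hzre : z.re = 1 := by
    simp only [hz, Complex.sub_re, Complex.one_re, Complex.mul_re, Complex.I_re, Complex.I_im,
      Complex.ofReal_im]
    ring
  have hz0 : z ≠ 0 := fun h => by simp [h] at hzre
  have hb : (-z / 2).re < 0 := by
    have : -z / 2 = ((-(1 / 2) : ℝ) : ℂ) * z := by push_cast; ring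
    rw [this, Complex.re_ofReal_mul, hzre]; norm_num
  have hrec : ∀ n : ℕ, gaussInt (-z / 2) c e (gaussPoly n) =
      v ^ n * ((gaussPoly n).eval ξ : ℝ) * gaussInt (-z / 2) c e 1 := by
    have hzinv : z⁻¹ = Complex.I * v * Real.sin θ := by
      refine inv_eq_of_mul_eq_one_right ?_
      linear_combination Complex.I * hzv - Complex.I_sq
    have hI : z * (Complex.I * v * Real.sin θ) = 1 := by rw [← hzinv, mul_inv_cancel₀ hz0]
    have hcz : c = -ξ * Complex.I / Real.sin θ := by rw [hc]; ring
    have step : ∀ n, gaussInt (-z / 2) c e (gaussPoly (n + 1)) =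
        (1 - 2 * Complex.I * v * Real.sin θ) * gaussInt (-z / 2) c e (derivative (gaussPoly n))
          - 2 * ξ * v * gaussInt (-z / 2) c e (gaussPoly n) := by
      intro n
      have h := gaussInt_gaussPoly_succ hb c e n
      have hc2 : c * (Complex.I * v * Real.sin θ) = ξ * v := by
        rw [hcz]; field_simp; linear_combination (-ξ : ℂ) * Complex.I_sq
      linear_combination (-2 * (Complex.I * v * Real.sin θ)) * h +
        (-gaussInt (-z / 2) c e (gaussPoly (n + 1)) +
          gaussInt (-z / 2) c e (derivative (gaussPoly n))) * hI -
          2 * gaussInt (-z / 2) c e (gaussPoly n) * hc2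
    have hv2 : 1 - 2 * Complex.I * v * Real.sin θ = v ^ 2 := by
      rw [hv1]
      linear_combination (-1 : ℂ) * hcs + ((Real.sin θ : ℂ) ^ 2) * Complex.I_sq
    intro n
    induction n using Nat.strong_induction_on with
    | _ n ih =>
      match n with
      | 0 => simp [gaussPoly]
      | 1 =>
        have h0 : gaussInt (-z / 2) c e (derivative (gaussPoly 0)) = 0 := by
          simp [gaussPoly, gaussInt]
        have h1 : (gaussPoly 1).eval ξ = -(2 * ξ) := by simp [gaussPoly]
        rw [step 0, h0, h1, show gaussPoly 0 = 1 from rfl]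
        push_cast
        ring
      | n + 2 =>
        rw [step (n + 1), ih (n + 1) (by omega), derivative_gaussPoly_succ, gaussInt_neg,
          gaussInt_C_mul, ih n (by omega), hv2, gaussPoly_eval_succ_succ]
        push_cast
        ring
  have hone : (z / (2 * (Real.pi : ℂ))) ^ (1 / 2 : ℂ) * gaussInt (-z / 2) c e 1 =
      Complex.exp (-ξ ^ 2 / 2) := by
    rw [gaussInt_one hb]
    have h1 : (Real.pi : ℂ) / -(-z / 2) = (z / (2 * (Real.pi : ℂ)))⁻¹ := by
      rw [inv_div]; field_simp
    have hre : 0 < (z / (2 * (Real.pi : ℂ))).re := by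
      have : z / (2 * (Real.pi : ℂ)) = (((2 * Real.pi)⁻¹ : ℝ) : ℂ) * z := by
        push_cast; rw [div_eq_inv_mul]
      rw [this, Complex.re_ofReal_mul, hzre]
      positivity
    -- Positive real part keeps the base off the branch cut, so the principal square root commutes
    -- with inversion.
    have harg : (z / (2 * (Real.pi : ℂ))).arg ≠ Real.pi := by
      intro h
      have := (Complex.arg_eq_pi_iff.1 h).1
      linarith
    have hne : (z / (2 * (Real.pi : ℂ))) ^ (1 / 2 : ℂ) ≠ 0 := by
      rw [Complex.cpow_ne_zero_iff]
      exact Or.inl fun h => by simp [h] at hre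
    rw [h1, Complex.inv_cpow _ _ harg, ← mul_assoc, mul_inv_cancel₀ hne, one_mul]
    congr 1
    have hcot : (Real.cot θ : ℂ) = Real.cos θ / Real.sin θ := by
      rw [Real.cot_eq_cos_div_sin]; push_cast; rfl
    have hz2 : z = -Complex.I / (v * Real.sin θ) := by
      rw [eq_div_iff (mul_ne_zero hv0 hs')]; linear_combination hzv
    rw [hz2, he, hc, hcot]
    have hI0 := Complex.I_ne_zero
    field_simp
    rw [hv1]
    linear_combination (4 * ξ ^ 2 * Real.sin θ : ℂ) * Complex.I_sq
  have hint : ∫ x : ℝ, fracKernel ϱ ξ x * (hermiteFun n x : ℂ) =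
      ((z / (2 * (Real.pi : ℂ))) ^ (1 / 2 : ℂ) * hermConst n) *
        gaussInt (-z / 2) c e (gaussPoly n) := by
    rw [gaussInt, ← integral_const_mul]
    exact integral_congr_ae (Filter.Eventually.of_forall fun x => fracKernel_mul_hermiteFun ϱ ξ x n)
  rw [hint, hrec, hermiteFun_eq]
  push_cast
  rw [← hone]
  ring

end GaussianMoments

/-! ### The fractional Fourier transform as a multiplier on Hermite coefficients. -/

/-- The unimodular factor `e^{-iπϱ/2}` by which `𝓕_ϱ` acts on Hermite functions of degree one. -/
noncomputable def fracPhase (ϱ : ℝ) : ℂ := Complex.exp (-(Complex.I * (Real.pi * ϱ / 2 : ℝ)))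

theorem norm_fracPhase (ϱ : ℝ) : ‖fracPhase ϱ‖ = 1 := by
  rw [fracPhase, ← neg_mul, neg_mul_comm, ← Complex.ofReal_neg, mul_comm]
  exact Complex.norm_exp_ofReal_mul_I _

theorem fracPhase_eq (ϱ : ℝ) :
    fracPhase ϱ = Real.cos (Real.pi * ϱ / 2) - Complex.I * Real.sin (Real.pi * ϱ / 2) := by
  rw [fracPhase, mul_comm, ← neg_mul, Complex.exp_mul_I, Complex.cos_neg, Complex.sin_neg]
  push_cast; ring

theorem fracPhase_eq_one {ϱ : ℝ} {k : ℤ} (h : ϱ = 4 * k) : fracPhase ϱ = 1 := by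
  rw [fracPhase, Complex.exp_eq_one_iff]
  refine ⟨-k, ?_⟩
  rw [h]; push_cast; ring

theorem fracPhase_eq_neg_one {ϱ : ℝ} {k : ℤ} (h : ϱ = 2 + 4 * k) : fracPhase ϱ = -1 := by
  have : -(Complex.I * (Real.pi * ϱ / 2 : ℝ)) =
      Real.pi * Complex.I + ((-k - 1 : ℤ) : ℂ) * (2 * Real.pi * Complex.I) := by
    rw [h]; push_cast; ring
  rw [fracPhase, this, Complex.exp_add, Complex.exp_int_mul_two_pi_mul_I, Complex.exp_pi_mul_I,
    mul_one]

theorem sin_fracPhase_ne_zero {ϱ : ℝ} (h0 : ¬ ∃ k : ℤ, ϱ = 4 * k) (h2 : ¬ ∃ k : ℤ, ϱ = 2 + 4 * k) :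
    Real.sin (Real.pi * ϱ / 2) ≠ 0 := by
  intro h
  obtain ⟨n, hn⟩ := Real.sin_eq_zero_iff.1 h
  have hϱ : ϱ = 2 * n := by
    have := Real.pi_ne_zero
    field_simp at hn
    linarith
  rcases Int.even_or_odd' n with ⟨k, hk | hk⟩
  · exact h0 ⟨k, by rw [hϱ, hk]; push_cast; ring⟩
  · exact h2 ⟨k, by rw [hϱ, hk]; push_cast; ring⟩

/-- The Hermite functions are eigenfunctions of the fractional Fourier transform. -/
theorem fracFourierFun_hermite {d : ℕ} (ϱ : ℝ) (β : Fin d → ℕ) (ξ : Fin d → ℝ) :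
    fracFourierFun ϱ (fun x => (hermite β x : ℂ)) ξ =
      fracPhase ϱ ^ (∑ j, β j) * (hermite β ξ : ℂ) := by
  unfold fracFourierFun
  split_ifs with h0 h2
  · obtain ⟨k, hk⟩ := h0
    rw [fracPhase_eq_one hk, one_pow, one_mul]
  · obtain ⟨k, hk⟩ := h2
    rw [fracPhase_eq_neg_one hk]
    simp only [hermite, Pi.neg_apply, hermiteFun_neg, Finset.prod_mul_distrib,
      Finset.prod_pow_eq_pow_sum]
    push_cast; rfl
  · have hs := sin_fracPhase_ne_zero h0 h2
    simp only [hermite, Complex.ofReal_prod, ← Finset.prod_mul_distrib]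
    rw [integral_fintype_prod_volume_eq_prod
      (fun j (t : ℝ) => fracKernel ϱ (ξ j) t * (hermiteFun (β j) t : ℂ))]
    simp only [integral_fracKernel_mul_hermiteFun hs, Finset.prod_mul_distrib,
      Finset.prod_pow_eq_pow_sum]
    rfl

theorem hermiteCoeff_const_mul_hermite {d : ℕ} (a : ℂ) (α β : Fin d → ℕ) :
    hermiteCoeff (fun x => a * (hermite β x : ℂ)) α = if β = α then a else 0 := by
  simp only [hermiteCoeff, hermite, Complex.ofReal_prod, mul_assoc, ← Finset.prod_mul_distrib]
  rw [integral_const_mul, integral_fintype_prod_volume_eq_prod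
      (fun j (t : ℝ) => (hermiteFun (β j) t : ℂ) * (hermiteFun (α j) t : ℂ))]
  simp only [integral_hermiteFun_mul]
  split_ifs with h
  · simp [h]
  · obtain ⟨j, hj⟩ := Function.ne_iff.1 h
    rw [Finset.prod_eq_zero (Finset.mem_univ j) (if_neg hj), mul_zero]

/-- By the eigenfunction property and orthonormality only the term `β = α` of the defining series
survives, so no growth condition on `f` is required. -/
theorem fracFourier_apply {d : ℕ} (ϱ : ℝ) (f : HermiteSeries d) (α : Fin d → ℕ) :
    fracFourier ϱ f α = fracPhase ϱ ^ (∑ j, α j) * f α := by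
  have h : ∀ β : Fin d → ℕ, fracFourierFun ϱ (fun x => (hermite β x : ℂ)) =
      fun ξ => fracPhase ϱ ^ (∑ j, β j) * (hermite β ξ : ℂ) :=
    fun β => funext (fracFourierFun_hermite ϱ β)
  unfold fracFourier
  rw [tsum_eq_single α]
  · simp only [h, hermiteCoeff_const_mul_hermite, if_true]
    ring
  · intro β hβ
    simp only [h, hermiteCoeff_const_mul_hermite, if_neg hβ, mul_zero]

/-- The propagator of the harmonic oscillator is a multiple of the fractional Fourier transform. -/
theorem oscPropagator_eq_smul_fracFourier {d : ℕ} (ϱ : ℝ) (c : ℂ) (f : HermiteSeries d) :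
    oscPropagator (-(Complex.I * ((Real.pi / 4 : ℝ) : ℂ))) (ϱ : ℂ) c f =
      Complex.exp (-(Complex.I * ((Real.pi / 4 : ℝ) : ℂ)) * ((d : ℂ) * (ϱ : ℂ) + c)) •
        fracFourier ϱ f := by
  funext α
  rw [Pi.smul_apply, smul_eq_mul, fracFourier_apply, ← mul_assoc, fracPhase, ← Complex.exp_nat_mul,
    ← Complex.exp_add, oscPropagator, oscEigenvalue]
  congr 2
  push_cast
  ring

/-! ### The short-time Fourier transform in terms of the Hermite coefficients -/

theorem gaussWindow_eq_prod {d : ℕ} (x : Fin d → ℝ) :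
    gaussWindow x = ∏ j, Real.pi ^ (-(1 / 4 : ℝ)) * Real.exp (-x j ^ 2 / 2) := by
  rw [gaussWindow, Finset.prod_mul_distrib, Finset.prod_const, Finset.card_univ, Fintype.card_fin,
    ← Real.rpow_natCast, ← Real.rpow_mul Real.pi_pos.le, ← Real.exp_sum, ← Finset.sum_div,
    Finset.sum_neg_distrib]
  ring_nf

/-- The window, the modulation and the Gaussian in `h_n` combine to `exp(-y² + (x + iξ)y - x²/2)`.
This is the case `b = -1`, where the Laplace transform of `P_n` is a pure power of `x + iξ`. -/
theorem integral_window_mul_hermiteFun (n : ℕ) (x ξ : ℝ) :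
    ∫ y : ℝ, (((Real.pi ^ (-(1 / 4 : ℝ)) * Real.exp (-(y - x) ^ 2 / 2) : ℝ) : ℂ) *
      Complex.exp (Complex.I * ((y * ξ : ℝ) : ℂ))) * (hermiteFun n y : ℂ) =
    (((Real.pi ^ (-(1 / 4 : ℝ)) : ℝ) : ℂ) * Real.sqrt Real.pi *
      Complex.exp (-x ^ 2 / 2 + (x + Complex.I * ξ) ^ 2 / 4)) *
      (hermConst n * (-(x + Complex.I * ξ)) ^ n) := by
  have h : ∀ y : ℝ, (((Real.pi ^ (-(1 / 4 : ℝ)) * Real.exp (-(y - x) ^ 2 / 2) : ℝ) : ℂ) *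
      Complex.exp (Complex.I * ((y * ξ : ℝ) : ℂ))) * (hermiteFun n y : ℂ) =
      (((Real.pi ^ (-(1 / 4 : ℝ)) : ℝ) : ℂ) * hermConst n) *
        ((((gaussPoly n).eval y : ℝ) : ℂ) *
          Complex.exp ((-1) * y ^ 2 + (x + Complex.I * ξ) * y + -x ^ 2 / 2)) := by
    intro y
    have e : Complex.exp ((-1) * y ^ 2 + (x + Complex.I * ξ) * y + -x ^ 2 / 2) =
        Complex.exp (-(y - x) ^ 2 / 2) * Complex.exp (Complex.I * (y * ξ)) *
          Complex.exp (-y ^ 2 / 2) := by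
      rw [← Complex.exp_add, ← Complex.exp_add]
      ring_nf
    rw [hermiteFun_eq, e]
    simp only [Complex.ofReal_mul, Complex.ofReal_exp, Complex.ofReal_div, Complex.ofReal_neg,
      Complex.ofReal_pow, Complex.ofReal_sub, Complex.ofReal_ofNat]
    ring
  simp_rw [h]
  rw [integral_const_mul]
  have := gaussInt_neg_one_gaussPoly (x + Complex.I * ξ) (-x ^ 2 / 2) n
  unfold gaussInt at this
  rw [this]
  ring

/-- The Gaussian factor relating the short-time Fourier transform to the Bargmann transform. -/
noncomputable def stftFactor {d : ℕ} (z : (Fin d → ℝ) × (Fin d → ℝ)) : ℂ :=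
  (((2 * Real.pi) ^ (-((d : ℝ) / 2)) : ℝ) : ℂ) *
    ∏ j, (((Real.pi ^ (-(1 / 4 : ℝ)) : ℝ) : ℂ) * Real.sqrt Real.pi *
      Complex.exp (-z.1 j ^ 2 / 2 + (z.1 j - Complex.I * z.2 j) ^ 2 / 4))

/-- The Taylor monomials of the Bargmann transform. -/
noncomputable def stftMonomial {d : ℕ} (α : Fin d → ℕ) (z : (Fin d → ℝ) × (Fin d → ℝ)) : ℂ :=
  ∏ j, ((hermConst (α j) : ℂ) * (-(z.1 j - Complex.I * z.2 j)) ^ α j)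

/-- The conjugation in the pairing replaces `x + iξ` by `x - iξ`. Pulling a constant out of `tsum`
is valid without convergence, so `f` may be any formal series. -/
theorem stft_eq {d : ℕ} (f : HermiteSeries d) (z : (Fin d → ℝ) × (Fin d → ℝ)) :
    stft f z = stftFactor z * ∑' α, f α * stftMonomial α z := by
  have h : ∀ α : Fin d → ℕ, (starRingEnd ℂ) (hermiteCoeff (fun y =>
      (gaussWindow (y - z.1) : ℂ) * Complex.exp (Complex.I * ((∑ j, y j * z.2 j : ℝ) : ℂ))) α) =
      (∏ j, (((Real.pi ^ (-(1 / 4 : ℝ)) : ℝ) : ℂ) * Real.sqrt Real.pi *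
        Complex.exp (-z.1 j ^ 2 / 2 + (z.1 j - Complex.I * z.2 j) ^ 2 / 4))) *
        stftMonomial α z := by
    intro α
    simp only [hermiteCoeff, gaussWindow_eq_prod, hermite, Complex.ofReal_prod, Complex.ofReal_sum,
      Finset.mul_sum, Complex.exp_sum, ← Finset.prod_mul_distrib, Pi.sub_apply]
    rw [integral_fintype_prod_volume_eq_prod (fun j (y : ℝ) =>
      (((Real.pi ^ (-(1 / 4 : ℝ)) * Real.exp (-(y - z.1 j) ^ 2 / 2) : ℝ) : ℂ) *
        Complex.exp (Complex.I * ((y * z.2 j : ℝ) : ℂ))) * (hermiteFun (α j) y : ℂ))]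
    simp only [integral_window_mul_hermiteFun]
    rw [map_prod, stftMonomial, ← Finset.prod_mul_distrib]
    refine Finset.prod_congr rfl fun j _ => ?_
    simp only [map_mul, map_pow, map_neg, map_add, Complex.conj_ofReal, Complex.conj_I,
      ← Complex.exp_conj, map_div₀, map_ofNat]
    ring_nf
  rw [stft, pairing, stftFactor, mul_assoc]
  congr 1
  rw [← tsum_mul_left]
  refine tsum_congr fun α => ?_
  rw [h]
  ring

theorem norm_stftFactor {d : ℕ} (z : (Fin d → ℝ) × (Fin d → ℝ)) :
    ‖stftFactor z‖ = ‖(((2 * Real.pi) ^ (-((d : ℝ) / 2)) : ℝ) : ℂ)‖ *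
      ∏ j, (‖((Real.pi ^ (-(1 / 4 : ℝ)) : ℝ) : ℂ) * Real.sqrt Real.pi‖ *
        Real.exp (-(z.1 j ^ 2 + z.2 j ^ 2) / 4)) := by
  rw [stftFactor, norm_mul, norm_prod]
  congr 1
  refine Finset.prod_congr rfl fun j _ => ?_
  rw [norm_mul, Complex.norm_exp]
  congr 2
  have : (-(z.1 j : ℂ) ^ 2 / 2 + (z.1 j - Complex.I * z.2 j) ^ 2 / 4) =
      ((-(z.1 j ^ 2 + z.2 j ^ 2) / 4 : ℝ) : ℂ) +
        ((-(z.1 j * z.2 j) / 2 : ℝ) : ℂ) * Complex.I := by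
    push_cast
    linear_combination ((z.2 j : ℂ) ^ 2 / 4) * Complex.I_sq
  rw [this, Complex.add_re, Complex.ofReal_re, Complex.re_ofReal_mul, Complex.I_re, mul_zero,
    add_zero]

/-- The cross term `x_j ξ_j` in the exponent is purely imaginary, so the modulus depends only on the
sums `x_j² + ξ_j²`, which the rotation preserves. -/
theorem norm_stftFactor_phaseRotation {d : ℕ} (ϱ : ℝ) (z : (Fin d → ℝ) × (Fin d → ℝ)) :
    ‖stftFactor (phaseRotation ϱ z)‖ = ‖stftFactor z‖ := by
  rw [norm_stftFactor, norm_stftFactor]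
  congr 1
  refine Finset.prod_congr rfl fun j _ => ?_
  congr 3
  simp only [phaseRotation, Pi.sub_apply, Pi.add_apply, Pi.smul_apply, smul_eq_mul]
  linear_combination (-(z.1 j ^ 2 + z.2 j ^ 2)) * Real.cos_sq_add_sin_sq (Real.pi * ϱ / 2)

/-- In the coordinates `x_j - iξ_j` the rotation is multiplication by `e^{-iθ}`, and the monomial is
homogeneous of degree `|α|`. -/
theorem stftMonomial_phaseRotation {d : ℕ} (ϱ : ℝ) (α : Fin d → ℕ)
    (z : (Fin d → ℝ) × (Fin d → ℝ)) :
    stftMonomial α (phaseRotation ϱ z) = fracPhase ϱ ^ (∑ j, α j) * stftMonomial α z := by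
  rw [stftMonomial, stftMonomial, ← Finset.prod_pow_eq_pow_sum, ← Finset.prod_mul_distrib]
  refine Finset.prod_congr rfl fun j _ => ?_
  have : -(((phaseRotation ϱ z).1 j : ℂ) - Complex.I * ((phaseRotation ϱ z).2 j : ℂ)) =
      fracPhase ϱ * -(z.1 j - Complex.I * z.2 j) := by
    rw [fracPhase_eq]
    simp only [phaseRotation, Pi.sub_apply, Pi.add_apply, Pi.smul_apply, smul_eq_mul,
      Complex.ofReal_sub, Complex.ofReal_add, Complex.ofReal_mul]
    linear_combination (Real.sin (Real.pi * ϱ / 2) * z.2 j : ℂ) * Complex.I_sq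
  rw [this, mul_pow]
  ring

/-- The fractional Fourier transform rotates the short-time Fourier transform. -/
theorem norm_stft_smul_fracFourier {d : ℕ} (k : ℂ) (ϱ : ℝ) (f : HermiteSeries d)
    (z : (Fin d → ℝ) × (Fin d → ℝ)) :
    ‖stft (k • fracFourier ϱ f) z‖ = ‖k‖ * ‖stft f (phaseRotation ϱ z)‖ := by
  have h : ∀ α, (k • fracFourier ϱ f) α * stftMonomial α z =
      k * (f α * stftMonomial α (phaseRotation ϱ z)) := by
    intro α
    rw [Pi.smul_apply, smul_eq_mul, fracFourier_apply, stftMonomial_phaseRotation]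
    ring
  simp_rw [stft_eq, h, tsum_mul_left, norm_mul, norm_stftFactor_phaseRotation]
  ring

/-! ### Convergence of the series for the short-time Fourier transform -/

theorem summable_prod_pow {d : ℕ} {a : ℝ} (h0 : 0 ≤ a) (h1 : a < 1) :
    Summable fun α : Fin d → ℕ => ∏ j, a ^ α j := by
  induction d with
  | zero => exact (hasSum_fintype _).summable
  | succ d ih =>
    rw [← (Fin.consEquiv fun _ : Fin (d + 1) => ℕ).summable_iff]
    have h := (summable_geometric_of_lt_one h0 h1).mul_of_nonneg ih (fun n => by positivity)
      (fun α => by positivity)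
    refine h.congr fun x => ?_
    simp [Fin.consEquiv, Fin.prod_univ_succ]

/-- The normalising constants decay at least like `(n!)^{-1/2}`, which compensates the factor
`(α!)^{1/2}` allowed to Pilipović coefficients. -/
theorem abs_hermConst_mul_sqrt_le (n : ℕ) : |hermConst n| * Real.sqrt n.factorial ≤ 1 := by
  have h := hermConst_sq n
  have h1 : (1 : ℝ) ≤ Real.sqrt Real.pi := Real.one_le_sqrt.2 (by linarith [Real.pi_gt_three])
  have h2 : (1 : ℝ) ≤ 2 ^ n := one_le_pow₀ (by norm_num)
  have h3 : (0 : ℝ) ≤ n.factorial := by positivity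
  refine abs_le_one_iff_mul_self_le_one.2 ?_ |> (le_abs_self _).trans
  have e : |hermConst n| * Real.sqrt n.factorial * (|hermConst n| * Real.sqrt n.factorial) =
      hermConst n ^ 2 * n.factorial := by
    rw [← sq, mul_pow, sq_abs, Real.sq_sqrt h3]
  rw [e, ← h]
  refine mul_le_mul_of_nonneg_left ?_ (sq_nonneg _)
  rw [← mul_assoc]
  exact le_mul_of_one_le_left h3 (one_le_mul_of_one_le_of_one_le h1 h2)

theorem summable_mul_stftMonomial {d : ℕ} {f : HermiteSeries d} (hf : f ∈ pilipovicDual d)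
    (z : (Fin d → ℝ) × (Fin d → ℝ)) : Summable fun α => f α * stftMonomial α z := by
  set R : ℝ := 1 + ∑ j, ‖-((z.1 j : ℂ) - Complex.I * z.2 j)‖ with hR
  have hR0 : 0 < R := by positivity
  -- `R` bounds every `|x_j - iξ_j|`; this choice of `r` makes the terms at most `C 2^{-|α|}`.
  obtain ⟨C, hC⟩ := hf (1 / (2 * R)) (by positivity)
  refine Summable.of_norm_bounded
    ((summable_prod_pow (d := d) (a := 1 / 2) (by norm_num) (by norm_num)).mul_left C) fun α => ?_
  have hC0 : 0 ≤ C := by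
    have := (norm_nonneg _).trans (hC 0)
    simpa using this
  rw [norm_mul, stftMonomial, norm_prod]
  have h2 : ∀ j, ‖(hermConst (α j) : ℂ) * (-((z.1 j : ℂ) - Complex.I * z.2 j)) ^ α j‖ ≤
      |hermConst (α j)| * R ^ α j := by
    intro j
    rw [norm_mul, norm_pow, Complex.norm_real, Real.norm_eq_abs]
    gcongr
    have := Finset.single_le_sum (f := fun j => ‖-((z.1 j : ℂ) - Complex.I * z.2 j)‖)
      (fun i _ => norm_nonneg _) (Finset.mem_univ j)
    linarith
  calc ‖f α‖ * ∏ j, ‖(hermConst (α j) : ℂ) * (-((z.1 j : ℂ) - Complex.I * z.2 j)) ^ α j‖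
      ≤ (C * (1 / (2 * R)) ^ (∑ j, α j) * Real.sqrt ((∏ j, (α j).factorial : ℕ) : ℝ)) *
        ∏ j, (|hermConst (α j)| * R ^ α j) := by
        refine mul_le_mul (hC α) (Finset.prod_le_prod (fun j _ => norm_nonneg _) fun j _ => h2 j)
          (Finset.prod_nonneg fun j _ => norm_nonneg _) (by positivity)
    _ = C * ∏ j, ((1 / 2) ^ α j * (|hermConst (α j)| * Real.sqrt (α j).factorial)) := by
        rw [← Finset.prod_pow_eq_pow_sum, Nat.cast_prod, Real.sqrt_eq_rpow,
          ← Real.finsetProd_rpow _ _ (fun j _ => by positivity), mul_assoc, mul_assoc,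
          ← Finset.prod_mul_distrib, ← Finset.prod_mul_distrib]
        congr 1
        refine Finset.prod_congr rfl fun j _ => ?_
        rw [Real.sqrt_eq_rpow, div_pow, mul_pow, div_pow]
        field_simp
    _ ≤ C * ∏ j, (1 / 2) ^ α j := by
        refine mul_le_mul_of_nonneg_left (Finset.prod_le_prod (fun j _ => by positivity)
          fun j _ => ?_) hC0
        exact mul_le_of_le_one_right (by positivity) (abs_hermConst_mul_sqrt_le _)

/-- Unlike scaling, additivity of `tsum` needs convergence; the growth condition supplies it. The
quasi-triangle inequalities rest on this. -/
theorem stft_add {d : ℕ} {f g : HermiteSeries d} (hf : f ∈ pilipovicDual d)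
    (hg : g ∈ pilipovicDual d) (z : (Fin d → ℝ) × (Fin d → ℝ)) :
    stft (f + g) z = stft f z + stft g z := by
  simp only [stft_eq, Pi.add_apply, add_mul]
  rw [(summable_mul_stftMonomial hf z).tsum_add (summable_mul_stftMonomial hg z), mul_add]

theorem measurable_stft {d : ℕ} {f : HermiteSeries d} (hf : f ∈ pilipovicDual d) :
    Measurable (stft f) := by
  have h1 : Measurable fun z : (Fin d → ℝ) × (Fin d → ℝ) => ∑' α, f α * stftMonomial α z := by
    refine measurable_of_tendsto_metrizable' Filter.atTop
      (f := fun (s : Finset (Fin d → ℕ)) z => ∑ α ∈ s, f α * stftMonomial α z) (fun s => ?_)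
      (tendsto_pi_nhds.2 fun z => (summable_mul_stftMonomial hf z).hasSum)
    unfold stftMonomial
    fun_prop
  have h2 : Measurable (stftFactor (d := d)) := by
    unfold stftFactor
    fun_prop
  exact (funext fun z => stft_eq f z) ▸ h2.mul h1

theorem pilipovicDual_add {d : ℕ} {f g : HermiteSeries d} (hf : f ∈ pilipovicDual d)
    (hg : g ∈ pilipovicDual d) : f + g ∈ pilipovicDual d := by
  intro r hr
  obtain ⟨C, hC⟩ := hf r hr
  obtain ⟨D, hD⟩ := hg r hr
  refine ⟨C + D, fun α => (norm_add_le _ _).trans ((add_le_add (hC α) (hD α)).trans_eq ?_)⟩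
  ring

theorem smul_fracFourier_mem_pilipovicDual {d : ℕ} (k : ℂ) (ϱ : ℝ) {f : HermiteSeries d}
    (hf : f ∈ pilipovicDual d) : k • fracFourier ϱ f ∈ pilipovicDual d := by
  intro r hr
  obtain ⟨C, hC⟩ := hf r hr
  refine ⟨‖k‖ * C, fun α => ?_⟩
  rw [Pi.smul_apply, norm_smul, fracFourier_apply, norm_mul, norm_pow, norm_fracPhase, one_pow,
    one_mul, mul_assoc, mul_assoc, ← mul_assoc C]
  exact mul_le_mul_of_nonneg_left (hC α) (norm_nonneg k)

theorem smul_fracFourier_add {d : ℕ} (k : ℂ) (ϱ : ℝ) (f g : HermiteSeries d) :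
    k • fracFourier ϱ (f + g) = k • fracFourier ϱ f + k • fracFourier ϱ g := by
  funext α
  simp only [Pi.smul_apply, Pi.add_apply, fracFourier_apply, smul_eq_mul]
  ring

theorem smul_fracFourier_sub {d : ℕ} (k : ℂ) (ϱ : ℝ) (f g : HermiteSeries d) :
    k • fracFourier ϱ (f - g) = k • fracFourier ϱ f - k • fracFourier ϱ g := by
  funext α
  simp only [Pi.smul_apply, Pi.sub_apply, fracFourier_apply, smul_eq_mul]
  ring

/-! ### Minkowski's inequality and mixed quasi-norms. -/

section MixedNorm

variable {X Y : Type*} [MeasurableSpace X] [MeasurableSpace Y] {μ : Measure X} {ν : Measure Y}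

/-- **Minkowski's integral inequality.** -/
theorem lintegral_rpow_lintegral_le [SFinite μ] [SigmaFinite ν] {G : X × Y → ℝ≥0∞}
    (hG : Measurable G) {r : ℝ} (hr : 1 ≤ r) :
    (∫⁻ y, (∫⁻ x, G (x, y) ∂μ) ^ r ∂ν) ^ (1 / r) ≤
      ∫⁻ x, (∫⁻ y, G (x, y) ^ r ∂ν) ^ (1 / r) ∂μ := by
  rcases hr.eq_or_lt with rfl | hr1
  · simp only [ENNReal.rpow_one, div_one]
    rw [lintegral_lintegral_swap (f := fun y x => G (x, y)) (by fun_prop)]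
  have hr0 : 0 < r := by linarith
  set H : Y → ℝ≥0∞ := fun y => ∫⁻ x, G (x, y) ∂μ with hH
  have hHm : Measurable H := hG.lintegral_prod_left'
  set N := ∫⁻ x, (∫⁻ y, G (x, y) ^ r ∂ν) ^ (1 / r) ∂μ with hN
  -- The duality argument ends by cancelling a power of `∫ H^r`, which must be finite. Hence `H` is
  -- truncated in height and to sets of finite measure, and monotone convergence removes the
  -- truncation.
  set T : ℕ → Y → ℝ≥0∞ := fun n => (spanningSets ν n).indicator (fun y => min (H y) n) with hT
  have hTm : ∀ n, Measurable (T n) := fun n =>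
    (hHm.min measurable_const).indicator (measurableSet_spanningSets ν n)
  have hTmono : Monotone T := by
    intro m n hmn y
    refine (Set.indicator_le_indicator_of_subset (monotone_spanningSets ν hmn)
      (fun _ => zero_le) y).trans (Set.indicator_le_indicator ?_)
    exact min_le_min_left _ (by exact_mod_cast hmn)
  have hTle : ∀ n y, T n y ≤ H y := fun n y =>
    Set.indicator_le' (fun _ _ => min_le_left _ _) (fun _ _ => zero_le) y
  have hTsup : ∀ y, ⨆ n, T n y = H y := by
    intro y
    refine le_antisymm (iSup_le fun n => hTle n y) (le_of_forall_lt fun c hc => ?_)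
    obtain ⟨m, hm⟩ := ENNReal.exists_nat_gt (ne_top_of_lt hc)
    set n := max m (spanningSetsIndex ν y)
    refine lt_of_lt_of_le ?_ (le_iSup _ n)
    have hy : y ∈ spanningSets ν n :=
      monotone_spanningSets ν (le_max_right _ _) (mem_spanningSetsIndex ν y)
    simp only [hT, Set.indicator_of_mem hy]
    exact lt_min hc (hm.trans_le (by exact_mod_cast le_max_left m _))
  have key : ∀ n, ∫⁻ y, T n y ^ r ∂ν ≤ N ^ r := by
    intro n
    set I := ∫⁻ y, T n y ^ r ∂ν with hI
    have hIfin : I ≠ ∞ := by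
      have h1 : I ≤ ∫⁻ y, (spanningSets ν n).indicator (fun _ => (n : ℝ≥0∞) ^ r) y ∂ν := by
        refine lintegral_mono fun y => ?_
        by_cases hy : y ∈ spanningSets ν n
        · simp only [hT, Set.indicator_of_mem hy]
          exact ENNReal.rpow_le_rpow (min_le_right _ _) hr0.le
        · simp [hT, Set.indicator_of_notMem hy, hr0]
      rw [lintegral_indicator (measurableSet_spanningSets ν n), setLIntegral_const] at h1
      refine ne_top_of_le_ne_top (ENNReal.mul_ne_top ?_ (measure_spanningSets_lt_top ν n).ne) h1
      exact ENNReal.rpow_ne_top_of_nonneg hr0.le (ENNReal.natCast_ne_top n)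
    have hconj : r.HolderConjugate (r / (r - 1)) := Real.HolderConjugate.conjExponent hr1
    -- Write `T^r ≤ H T^{r-1}`, exchange the integrals and apply Hölder's inequality in `y` for each
    -- fixed `x`.
    have h1 : I ≤ N * I ^ (1 - 1 / r) := by
      calc I ≤ ∫⁻ y, H y * T n y ^ (r - 1) ∂ν := by
            refine lintegral_mono fun y => ?_
            simp only
            have : T n y ^ r = T n y * T n y ^ (r - 1) := by
              conv_lhs => rw [show r = 1 + (r - 1) by ring,
                ENNReal.rpow_add_of_nonneg _ _ zero_le_one (by linarith), ENNReal.rpow_one]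
            rw [this]
            gcongr
            exact hTle n y
        _ = ∫⁻ y, ∫⁻ x, G (x, y) * T n y ^ (r - 1) ∂μ ∂ν := by
            refine lintegral_congr fun y => ?_
            rw [lintegral_mul_const]
            fun_prop
        _ = ∫⁻ x, ∫⁻ y, G (x, y) * T n y ^ (r - 1) ∂ν ∂μ :=
            lintegral_lintegral_swap (f := fun y x => G (x, y) * T n y ^ (r - 1)) (by fun_prop)
        _ ≤ ∫⁻ x, (∫⁻ y, G (x, y) ^ r ∂ν) ^ (1 / r) * I ^ (1 - 1 / r) ∂μ := by
            refine lintegral_mono fun x => ?_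
            refine (ENNReal.lintegral_mul_le_Lp_mul_Lq ν hconj (by fun_prop)
              ((hTm n).pow_const _).aemeasurable).trans_eq ?_
            congr 1
            have hr' : r - 1 ≠ 0 := by linarith
            have e1 : (r - 1) * (r / (r - 1)) = r := by field_simp
            have e2 : 1 / (r / (r - 1)) = 1 - 1 / r := by field_simp
            simp only [← ENNReal.rpow_mul, e1, e2, hI]
        _ = N * I ^ (1 - 1 / r) := by
            rw [lintegral_mul_const]
            fun_prop
    rcases eq_or_ne I 0 with h0 | h0
    · rw [h0]; exact zero_le
    · have h2 : I = I ^ (1 / r) * I ^ (1 - 1 / r) := by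
        rw [← ENNReal.rpow_add _ _ h0 hIfin]; simp
      have h3 : I ^ (1 / r) ≤ N := by
        nth_rewrite 1 [h2] at h1
        refine (ENNReal.mul_le_mul_iff_left ?_ ?_).1 h1
        · simp [ENNReal.rpow_eq_zero_iff, h0, hIfin]
        · refine ENNReal.rpow_ne_top_of_nonneg ?_ hIfin
          rw [sub_nonneg, div_le_one hr0]; exact hr
      calc I = (I ^ (1 / r)) ^ r := by rw [← ENNReal.rpow_mul]; simp [hr0.ne']
        _ ≤ N ^ r := ENNReal.rpow_le_rpow h3 hr0.le
  have hsup : ∫⁻ y, H y ^ r ∂ν ≤ N ^ r := by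
    have : ∀ y, H y ^ r = ⨆ n, T n y ^ r := by
      intro y
      rw [← hTsup y]
      exact (ENNReal.orderIsoRpow r hr0).map_iSup _
    simp_rw [this]
    rw [lintegral_iSup (fun n => (hTm n).pow_const r)
      (fun m n hmn y => ENNReal.rpow_le_rpow (hTmono hmn y) hr0.le)]
    exact iSup_le key
  calc (∫⁻ y, H y ^ r ∂ν) ^ (1 / r) ≤ (N ^ r) ^ (1 / r) :=
        ENNReal.rpow_le_rpow hsup (by positivity)
    _ = N := by rw [← ENNReal.rpow_mul]; simp [hr0.ne']

theorem measurable_eLpNorm_prodMk [SFinite ν] {F : X × Y → ℝ≥0∞} (hF : Measurable F) (p : ℝ≥0∞) :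
    Measurable fun x => eLpNorm (fun y => F (x, y)) p ν := by
  rcases eq_or_ne p 0 with rfl | h0
  · simp
  rcases eq_or_ne p ∞ with rfl | hp
  · refine measurable_of_Iic fun c => ?_
    -- An essential supremum is at most `c` exactly when the slice of `{F > c}` is null, and slice
    -- measures are measurable in `x`.
    have : (fun x => eLpNorm (fun y => F (x, y)) ∞ ν) ⁻¹' Set.Iic c =
        {x | ν (Prod.mk x ⁻¹' {z | c < F z}) = 0} := by
      ext x
      simp only [Set.mem_preimage, Set.mem_Iic, Set.mem_ofPred_eq, eLpNorm_exponent_top,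
        eLpNormEssSup, enorm_eq_self]
      constructor
      · intro h
        have := (ENNReal.ae_le_essSup (μ := ν) fun y => F (x, y)).mono fun y hy => hy.trans h
        simpa [ae_iff] using this
      · intro h
        refine essSup_le_of_ae_le c ?_
        simpa [Filter.EventuallyLE, ae_iff] using h
    rw [this]
    exact measurable_measure_prodMk_left (measurableSet_lt measurable_const hF)
      (measurableSet_singleton 0)
  · simp only [eLpNorm_eq_lintegral_rpow_enorm_toReal h0 hp, enorm_eq_self]
    exact ((hF.pow_const _).lintegral_prod_right').pow_const _

/-- Minkowski's inequality for mixed `L^p` quasi-norms: taking the norm with the larger exponent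
first gives the larger value. -/
theorem eLpNorm_eLpNorm_swap_le [SigmaFinite μ] [SigmaFinite ν] {F : X × Y → ℝ≥0∞}
    (hF : Measurable F) {p q : ℝ≥0∞} (hq : 0 < q) (hqp : q ≤ p) :
    eLpNorm (fun y => eLpNorm (fun x => F (x, y)) q μ) p ν ≤
      eLpNorm (fun x => eLpNorm (fun y => F (x, y)) p ν) q μ := by
  rcases eq_or_ne p ∞ with rfl | hp
  · set M : X → ℝ≥0∞ := fun x => eLpNorm (fun y => F (x, y)) ∞ ν with hM
    have hMm : Measurable M := measurable_eLpNorm_prodMk hF ∞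
    have h1 : ∀ᵐ x ∂μ, ∀ᵐ y ∂ν, F (x, y) ≤ M x := Filter.Eventually.of_forall fun x => by
      simpa [hM, eLpNorm_exponent_top, eLpNormEssSup] using
        ENNReal.ae_le_essSup (μ := ν) fun y => F (x, y)
    rw [Measure.ae_ae_comm (p := fun x y => F (x, y) ≤ M x)
      (measurableSet_le hF (hMm.comp measurable_fst))] at h1
    rw [eLpNorm_exponent_top, eLpNormEssSup]
    refine essSup_le_of_ae_le _ (h1.mono fun y hy => ?_)
    exact eLpNorm_mono_enorm_ae (hy.mono fun x hx => by simpa using hx)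
  · have hq' : q ≠ ∞ := ne_top_of_le_ne_top hp hqp
    have hp0 : p ≠ 0 := (hq.trans_le hqp).ne'
    have hqr : 0 < q.toReal := ENNReal.toReal_pos hq.ne' hq'
    have hpr : 0 < p.toReal := ENNReal.toReal_pos hp0 hp
    have hr : 1 ≤ p.toReal / q.toReal := by
      rw [le_div_iff₀ hqr, one_mul]; exact ENNReal.toReal_mono hp hqp
    -- Minkowski's inequality is applied to `F ^ q` with exponent `p / q ≥ 1`, so `q < 1` is covered
    -- as well.
    have h := lintegral_rpow_lintegral_le (μ := μ) (ν := ν) (hF.pow_const q.toReal) hr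
    simp only [eLpNorm_eq_lintegral_rpow_enorm_toReal hp0 hp,
      eLpNorm_eq_lintegral_rpow_enorm_toReal hq.ne' hq', enorm_eq_self, ← ENNReal.rpow_mul]
    have h2 := ENNReal.rpow_le_rpow h (z := 1 / q.toReal) (by positivity)
    simp only [← ENNReal.rpow_mul] at h2
    have e1 : 1 / q.toReal * p.toReal = p.toReal / q.toReal := by ring
    have e2 : 1 / (p.toReal / q.toReal) * (1 / q.toReal) = 1 / p.toReal := by field_simp
    have e3 : q.toReal * (p.toReal / q.toReal) = p.toReal := by field_simp
    have e4 : 1 / (p.toReal / q.toReal) = 1 / p.toReal * q.toReal := by field_simp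
    rw [e2] at h2
    simp only [e3, e4] at h2
    simpa only [e1] using h2

/-- The mixed quasi-norm of an extended nonnegative function: `L^p` in the first variable, then
`L^q` in the second one. -/
noncomputable def mixedENorm (μ : Measure X) (ν : Measure Y) (p q : ℝ≥0∞) (F : X × Y → ℝ≥0∞) :
    ℝ≥0∞ :=
  eLpNorm (fun y => eLpNorm (fun x => F (x, y)) p μ) q ν

theorem eLpNorm_le_const_mul {F G : X → ℝ≥0∞} {C : ℝ≥0∞} (hC : C ≠ ∞) (p : ℝ≥0∞)
    (h : ∀ x, F x ≤ C * G x) : eLpNorm F p μ ≤ C * eLpNorm G p μ := by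
  lift C to NNReal using hC
  exact eLpNorm_le_mul_eLpNorm_of_ae_le_mul' (Filter.Eventually.of_forall fun x => by
    simpa using h x) p

theorem mixedENorm_le_mul {F G : X × Y → ℝ≥0∞} {C : ℝ≥0∞} (hC : C ≠ ∞) (p q : ℝ≥0∞)
    (h : ∀ z, F z ≤ C * G z) : mixedENorm μ ν p q F ≤ C * mixedENorm μ ν p q G :=
  eLpNorm_le_const_mul hC q fun y => eLpNorm_le_const_mul hC p fun x => h (x, y)

/-- Almost every slice of a null set is null. Weights are only a.e. measurable, and this permits
passing to measurable representatives. -/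
theorem mixedENorm_congr_ae [SFinite μ] [SFinite ν] {F G : X × Y → ℝ≥0∞} (p q : ℝ≥0∞)
    (h : F =ᵐ[μ.prod ν] G) : mixedENorm μ ν p q F = mixedENorm μ ν p q G := by
  have h1 : ∀ᵐ z ∂ν.prod μ, F z.swap = G z.swap :=
    Measure.measurePreserving_swap.quasiMeasurePreserving.ae h
  refine eLpNorm_congr_ae ?_
  filter_upwards [Measure.ae_ae_of_ae_prod h1] with y hy
  exact eLpNorm_congr_ae hy

theorem mixedENorm_add_le [SFinite μ] [SFinite ν] {F G : X × Y → ℝ≥0∞}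
    (hF : AEMeasurable F (μ.prod ν)) (hG : AEMeasurable G (μ.prod ν)) (p q : ℝ≥0∞) :
    mixedENorm μ ν p q (F + G) ≤
      ENNReal.LpAddConst p * ENNReal.LpAddConst q * (mixedENorm μ ν p q F + mixedENorm μ ν p q G) := by
  rw [mixedENorm_congr_ae p q (hF.ae_eq_mk.add hG.ae_eq_mk), mixedENorm_congr_ae p q hF.ae_eq_mk,
    mixedENorm_congr_ae p q hG.ae_eq_mk]
  set F' := hF.mk F
  set G' := hG.mk G
  have hF' : Measurable F' := hF.measurable_mk
  have hG' : Measurable G' := hG.measurable_mk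
  have m1 : Measurable fun y => eLpNorm (fun x => F' (x, y)) p μ :=
    measurable_eLpNorm_prodMk (hF'.comp measurable_swap) p
  have m2 : Measurable fun y => eLpNorm (fun x => G' (x, y)) p μ :=
    measurable_eLpNorm_prodMk (hG'.comp measurable_swap) p
  calc mixedENorm μ ν p q (F' + G') ≤ ENNReal.LpAddConst p * eLpNorm
        ((fun y => eLpNorm (fun x => F' (x, y)) p μ) + fun y => eLpNorm (fun x => G' (x, y)) p μ)
          q ν := by
        refine eLpNorm_le_const_mul (ENNReal.LpAddConst_lt_top p).ne q fun y => ?_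
        have hf : Measurable fun x => F' (x, y) := by fun_prop
        have hg : Measurable fun x => G' (x, y) := by fun_prop
        exact eLpNorm_add_le' hf.aestronglyMeasurable hg.aestronglyMeasurable p
    _ ≤ ENNReal.LpAddConst p * (ENNReal.LpAddConst q * (mixedENorm μ ν p q F' + mixedENorm μ ν p q G')) := by
        gcongr
        exact eLpNorm_add_le' m1.aestronglyMeasurable m2.aestronglyMeasurable q
    _ = _ := by rw [mul_assoc]

end MixedNorm

/-! ### Linear changes of variables in mixed quasi-norms. -/

section ChangeOfVariables

variable {d : ℕ}

/-- The factor by which `x ↦ a x + v` on `ℝ^d` changes the `L^p` quasi-norm. -/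
noncomputable def dilationConst (d : ℕ) (a : ℝ) (p : ℝ≥0∞) : ℝ≥0∞ :=
  ENNReal.ofReal |(a ^ d)⁻¹| ^ (1 / p).toReal

theorem dilationConst_ne_top (d : ℕ) (a : ℝ) (p : ℝ≥0∞) : dilationConst d a p ≠ ∞ :=
  ENNReal.rpow_ne_top_of_nonneg ENNReal.toReal_nonneg ENNReal.ofReal_ne_top

theorem eLpNorm_comp_smul_add {a : ℝ} (ha : a ≠ 0) (v : Fin d → ℝ) (F : (Fin d → ℝ) → ℝ≥0∞)
    (p : ℝ≥0∞) :
    eLpNorm (fun x => F (a • x + v)) p volume = dilationConst d a p * eLpNorm F p volume := by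
  have h1 : Measure.map (fun x : Fin d → ℝ => a • x + v) volume =
      ENNReal.ofReal |(a ^ d)⁻¹| • volume := by
    have h2 : (fun x : Fin d → ℝ => a • x + v) = (fun x => x + v) ∘ fun x => a • x := rfl
    rw [h2, ← Measure.map_map (by fun_prop) (by fun_prop), Measure.map_addHaar_smul _ ha,
      Measure.map_smul, map_add_right_eq_self, Module.finrank_fin_fun]
  have he : MeasurableEmbedding (fun x : Fin d → ℝ => a • x + v) :=
    ((Homeomorph.smulOfNeZero a ha).trans (Homeomorph.addRight v)).measurableEmbedding
  have h3 := he.eLpNorm_map_measure (g := F) (p := p) (μ := volume)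
  have h0 : ENNReal.ofReal |(a ^ d)⁻¹| ≠ 0 := by
    simp [ha]
  rw [h1, eLpNorm_smul_measure_of_ne_zero h0, smul_eq_mul] at h3
  exact h3.symm

/-- The linear map on phase space with the real `2 × 2` matrix `(a, b; e, f)`. -/
def blockMap (a b e f : ℝ) (z : (Fin d → ℝ) × (Fin d → ℝ)) : (Fin d → ℝ) × (Fin d → ℝ) :=
  (a • z.1 + b • z.2, e • z.1 + f • z.2)

/-- An invertible linear map scales Haar measure, so composition with it respects a.e. equality and
measurable representatives may be chosen before composing. -/
theorem quasiMeasurePreserving_blockMap {a b e f : ℝ} (hdet : a * f - b * e ≠ 0) :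
    Measure.QuasiMeasurePreserving (blockMap (d := d) a b e f) := by
  set D := a * f - b * e with hD
  let L : ((Fin d → ℝ) × (Fin d → ℝ)) ≃ₗ[ℝ] ((Fin d → ℝ) × (Fin d → ℝ)) :=
    { toFun := blockMap a b e f
      invFun := blockMap (D⁻¹ * f) (-(D⁻¹ * b)) (-(D⁻¹ * e)) (D⁻¹ * a)
      map_add' := fun x y => by ext <;> simp [blockMap] <;> ring
      map_smul' := fun r x => by ext <;> simp [blockMap] <;> ring
      left_inv := fun x => by
        ext <;> simp [blockMap] <;> field_simp <;> rw [hD] <;> ring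
      right_inv := fun x => by
        ext <;> simp [blockMap] <;> field_simp <;> rw [hD] <;> ring }
  have hm : Measurable (blockMap (d := d) a b e f) := by unfold blockMap; fun_prop
  refine ⟨hm, ?_⟩
  have : ((volume : Measure (Fin d → ℝ)).prod
      (volume : Measure (Fin d → ℝ))).IsAddHaarMeasure := Measure.prod.instIsAddHaarMeasure _ _
  have h := Measure.map_linearMap_addHaar_eq_smul_addHaar
    ((volume : Measure (Fin d → ℝ)).prod (volume : Measure (Fin d → ℝ)))
    (f := (L : _ →ₗ[ℝ] _)) L.isUnit_det'.ne_zero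
  have h' : Measure.map (blockMap (d := d) a b e f) volume = _ := h
  rw [h']
  exact Measure.smul_absolutelyContinuous

/-- Since `e ≠ 0`, the inner `L^q` integral in `x` can be taken over `y = e x + f ξ`, which makes
the first argument `(a / e) y + g ξ` with `g = b - a f / e`. Minkowski's inequality moves the `L^p`
norm in `ξ` inside, where the substitution in `ξ` is possible because `g` is minus the determinant
divided by `e`. -/
theorem mixedENorm_comp_blockMap_le {p q : ℝ≥0∞} (hq : 0 < q) (hqp : q ≤ p) {a b e f : ℝ}
    (he : e ≠ 0) (hdet : a * f - b * e ≠ 0) {F : (Fin d → ℝ) × (Fin d → ℝ) → ℝ≥0∞}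
    (hF : AEMeasurable F) :
    mixedENorm volume volume q p (fun z => F (blockMap a b e f z)) ≤
      dilationConst d e q * dilationConst d (b - a * f / e) p * mixedENorm volume volume p q F := by
  have hqmp := quasiMeasurePreserving_blockMap (d := d) hdet
  rw [mixedENorm_congr_ae p q hF.ae_eq_mk]
  refine (mixedENorm_congr_ae q p (hqmp.ae_eq_comp hF.ae_eq_mk)).trans_le ?_
  set F' := hF.mk F with hFdef
  have hF' : Measurable F' := hF.measurable_mk
  have hg : b - a * f / e ≠ 0 := by
    intro h
    apply hdet
    field_simp at h
    linarith
  set g := b - a * f / e with hgdef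
  have h1 : ∀ ξ : Fin d → ℝ, eLpNorm (fun x => F' (blockMap a b e f (x, ξ))) q volume =
      dilationConst d e q * eLpNorm (fun y => F' ((a / e) • y + g • ξ, y)) q volume := by
    intro ξ
    rw [← eLpNorm_comp_smul_add he (f • ξ)]
    congr 1
    funext x
    congr 1
    refine Prod.ext ?_ rfl
    ext j
    simp only [blockMap, Pi.add_apply, Pi.smul_apply, smul_eq_mul, hgdef]
    field_simp
    ring
  calc mixedENorm volume volume q p (F' ∘ blockMap a b e f)
      ≤ dilationConst d e q * eLpNorm (fun ξ : Fin d → ℝ =>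
          eLpNorm (fun y : Fin d → ℝ => F' ((a / e) • y + g • ξ, y)) q volume) p volume :=
        eLpNorm_le_const_mul (dilationConst_ne_top d e q) p fun ξ => (h1 ξ).le
    _ ≤ dilationConst d e q * eLpNorm (fun y : Fin d → ℝ =>
          eLpNorm (fun ξ : Fin d → ℝ => F' ((a / e) • y + g • ξ, y)) p volume) q volume := by
        gcongr
        exact eLpNorm_eLpNorm_swap_le (F := fun z : (Fin d → ℝ) × (Fin d → ℝ) =>
          F' ((a / e) • z.1 + g • z.2, z.1)) (by fun_prop) hq hqp
    _ ≤ dilationConst d e q * (dilationConst d g p * mixedENorm volume volume p q F') := by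
        gcongr
        refine eLpNorm_le_const_mul (dilationConst_ne_top d g p) q fun y => ?_
        have h2 := eLpNorm_comp_smul_add hg ((a / e) • y) (fun u => F' (u, y)) p
        simp only [add_comm (g • _)] at h2
        exact h2.le
    _ = _ := by rw [mul_assoc]

end ChangeOfVariables

/-! ### From quasi-norm bounds to continuity on sums and intersections. -/

variable {d : ℕ}

/-- `T` maps `X` into `Y` with `‖T f‖_Y ≤ C ‖f‖_X` for some finite `C`. -/
def GaugeBounded (T : HermiteSeries d → HermiteSeries d) (X Y : GaugedSpace d) : Prop :=
  ∃ C : ℝ≥0∞, C ≠ ∞ ∧ ∀ f ∈ X.carrier, T f ∈ Y.carrier ∧ Y.gauge (T f) ≤ C * X.gauge f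

theorem mapsContinuously_sum {T : HermiteSeries d → HermiteSeries d}
    (hsub : ∀ f g, T (f - g) = T f - T g) {X₁ X₂ Y : GaugedSpace d} {C : ℝ≥0∞} (hC : C ≠ ∞)
    (h : ∀ g ∈ X₁.carrier, ∀ h ∈ X₂.carrier, T (g + h) ∈ Y.carrier ∧
      Y.gauge (T (g + h)) ≤ C * (X₁.gauge g + X₂.gauge h)) :
    MapsContinuously T (X₁.sum X₂) Y := by
  refine ⟨?_, ?_⟩
  · rintro _ ⟨g, hg, k, hk, rfl⟩
    exact (h g hg k hk).1
  · refine @Continuous.mk _ _ (X₁.sum X₂).topology Y.topology _ fun U hU f hf => ?_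
    obtain ⟨ε, hε, hεU⟩ := hU _ hf
    -- `C + 1` keeps the divisor nonzero. The gauge of `f' - f` being an infimum, some decomposition
    -- `g + k` already has cost below this radius.
    refine ⟨ε / (C + 1), ENNReal.div_pos hε.ne' (by simp [hC]), fun f' hf' => hεU _ ?_⟩
    obtain ⟨g, hf'⟩ := iInf_lt_iff.1 hf'
    obtain ⟨hg, hf'⟩ := iInf_lt_iff.1 hf'
    obtain ⟨k, hf'⟩ := iInf_lt_iff.1 hf'
    obtain ⟨hk, hf'⟩ := iInf_lt_iff.1 hf'
    obtain ⟨hgk, hf'⟩ := iInf_lt_iff.1 hf'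
    change Y.gauge (T f' - T f) < ε
    rw [← hsub, ← hgk]
    calc Y.gauge (T (g + k)) ≤ C * (X₁.gauge g + X₂.gauge k) := (h g hg k hk).2
      _ ≤ (C + 1) * (X₁.gauge g + X₂.gauge k) := by gcongr; exact le_self_add
      _ < ε := ENNReal.mul_lt_of_lt_div' hf'

/-- `T g + T k` is itself an admissible decomposition in the target, so no quasi-triangle inequality
enters. -/
theorem GaugeBounded.mapsContinuously_sum_sum {T : HermiteSeries d → HermiteSeries d}
    (hadd : ∀ f g, T (f + g) = T f + T g) (hsub : ∀ f g, T (f - g) = T f - T g)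
    {X₁ X₂ Y₁ Y₂ : GaugedSpace d} (h₁ : GaugeBounded T X₁ Y₁) (h₂ : GaugeBounded T X₂ Y₂) :
    MapsContinuously T (X₁.sum X₂) (Y₁.sum Y₂) := by
  obtain ⟨C, hC, hC'⟩ := h₁
  obtain ⟨D, hD, hD'⟩ := h₂
  refine mapsContinuously_sum hsub (C := max C D) (by simp [hC, hD]) fun g hg k hk => ?_
  obtain ⟨m1, l1⟩ := hC' g hg
  obtain ⟨m2, l2⟩ := hD' k hk
  refine ⟨⟨T g, m1, T k, m2, (hadd g k).symm⟩, ?_⟩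
  refine (iInf₂_le_of_le (T g) m1 (iInf₂_le_of_le (T k) m2
    (iInf_le_of_le (hadd g k).symm (add_le_add l1 l2)))).trans ?_
  rw [mul_add]
  gcongr
  · exact le_max_left _ _
  · exact le_max_right _ _

theorem GaugedSpace.sum_comm (X Y : GaugedSpace d) : X.sum Y = Y.sum X := by
  unfold GaugedSpace.sum
  congr 1
  · ext f
    constructor <;> rintro ⟨g, hg, k, hk, h⟩ <;> exact ⟨k, hk, g, hg, (add_comm _ _).trans h⟩
  · funext f
    apply le_antisymm <;>
      exact le_iInf₂ fun g hg => le_iInf₂ fun k hk => le_iInf fun h =>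
        iInf₂_le_of_le k hk (iInf₂_le_of_le g hg
          (iInf_le_of_le ((add_comm _ _).trans h) (add_comm _ _).le))

/-- Here `T g` and `T k` must both lie in each target space and be added there, hence the four
bounds and the quasi-triangle constant `A`. -/
theorem GaugeBounded.mapsContinuously_sum_inter {T : HermiteSeries d → HermiteSeries d}
    (hadd : ∀ f g, T (f + g) = T f + T g) (hsub : ∀ f g, T (f - g) = T f - T g)
    {X₁ X₂ Y₁ Y₂ : GaugedSpace d} (h₁₁ : GaugeBounded T X₁ Y₁) (h₁₂ : GaugeBounded T X₁ Y₂)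
    (h₂₁ : GaugeBounded T X₂ Y₁) (h₂₂ : GaugeBounded T X₂ Y₂) {A : ℝ≥0∞} (hA : A ≠ ∞)
    (hY₁ : ∀ f ∈ Y₁.carrier, ∀ g ∈ Y₁.carrier,
      f + g ∈ Y₁.carrier ∧ Y₁.gauge (f + g) ≤ A * (Y₁.gauge f + Y₁.gauge g))
    (hY₂ : ∀ f ∈ Y₂.carrier, ∀ g ∈ Y₂.carrier,
      f + g ∈ Y₂.carrier ∧ Y₂.gauge (f + g) ≤ A * (Y₂.gauge f + Y₂.gauge g)) :
    MapsContinuously T (X₁.sum X₂) (Y₁.inter Y₂) := by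
  obtain ⟨C₁₁, hC₁₁, b₁₁⟩ := h₁₁
  obtain ⟨C₁₂, hC₁₂, b₁₂⟩ := h₁₂
  obtain ⟨C₂₁, hC₂₁, b₂₁⟩ := h₂₁
  obtain ⟨C₂₂, hC₂₂, b₂₂⟩ := h₂₂
  refine mapsContinuously_sum hsub (C := A * (max (max C₁₁ C₁₂) (max C₂₁ C₂₂)))
    (ENNReal.mul_ne_top hA (by simp [*])) fun g hg k hk => ?_
  obtain ⟨m₁, l₁⟩ := hY₁ _ (b₁₁ g hg).1 _ (b₂₁ k hk).1
  obtain ⟨m₂, l₂⟩ := hY₂ _ (b₁₂ g hg).1 _ (b₂₂ k hk).1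
  rw [hadd]
  refine ⟨⟨m₁, m₂⟩, ?_⟩
  rw [mul_assoc, mul_add]
  refine max_le (l₁.trans ?_) (l₂.trans ?_)
  · gcongr
    · refine (b₁₁ g hg).2.trans ?_
      gcongr
      exact (le_max_left _ _).trans (le_max_left _ _)
    · refine (b₂₁ k hk).2.trans ?_
      gcongr
      exact (le_max_left _ _).trans (le_max_right _ _)
  · gcongr
    · refine (b₁₂ g hg).2.trans ?_
      gcongr
      exact (le_max_right _ _).trans (le_max_left _ _)
    · refine (b₂₂ k hk).2.trans ?_
      gcongr
      exact (le_max_right _ _).trans (le_max_right _ _)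

/-! ### Weighted short-time Fourier transforms -/

/-- The modulus of the weighted short-time Fourier transform. -/
noncomputable def weightedStft (f : HermiteSeries d) (ω : (Fin d → ℝ) × (Fin d → ℝ) → ℝ)
    (z : (Fin d → ℝ) × (Fin d → ℝ)) : ℝ≥0∞ :=
  ‖stft f z * (ω z : ℂ)‖ₑ

theorem modulationSpace_gauge (p q : ℝ≥0∞) (ω : (Fin d → ℝ) × (Fin d → ℝ) → ℝ)
    (f : HermiteSeries d) :
    (modulationSpace p q ω).gauge f = mixedENorm volume volume p q (weightedStft f ω) := by
  simp only [modulationSpace, mixedNorm, mixedENorm, weightedStft, eLpNorm_enorm]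

theorem amalgamSpace_gauge (p q : ℝ≥0∞) (ω : (Fin d → ℝ) × (Fin d → ℝ) → ℝ)
    (f : HermiteSeries d) :
    (amalgamSpace p q ω).gauge f =
      mixedENorm volume volume q p (fun z => weightedStft f ω z.swap) := by
  simp only [amalgamSpace, mixedNormStar, mixedENorm, weightedStft, Prod.swap_prod_mk,
    eLpNorm_enorm]

/-- Local boundedness includes a.e. measurability on compact sets, and countably many of these cover
phase space. -/
theorem IsWeight.aemeasurable {ω : (Fin d → ℝ) × (Fin d → ℝ) → ℝ} (hω : IsWeight ω) :
    AEMeasurable ω := by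
  have h : AEMeasurable ω (volume.restrict
      (⋃ n, compactCovering ((Fin d → ℝ) × (Fin d → ℝ)) n)) :=
    aemeasurable_iUnion_iff.2 fun n =>
      (hω.memLp _ (isCompact_compactCovering _ n)).aestronglyMeasurable.aemeasurable
  rwa [iUnion_compactCovering, Measure.restrict_univ] at h

theorem aemeasurable_weightedStft {f : HermiteSeries d} (hf : f ∈ pilipovicDual d)
    {ω : (Fin d → ℝ) × (Fin d → ℝ) → ℝ} (hω : IsWeight ω) : AEMeasurable (weightedStft f ω) :=
  ((measurable_stft hf).aemeasurable.mul hω.aemeasurable.complex_ofReal).enorm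

theorem aemeasurable_comp_swap {F : (Fin d → ℝ) × (Fin d → ℝ) → ℝ≥0∞} (hF : AEMeasurable F) :
    AEMeasurable fun z : (Fin d → ℝ) × (Fin d → ℝ) => F z.swap :=
  hF.comp_quasiMeasurePreserving Measure.measurePreserving_swap.quasiMeasurePreserving

theorem weightedStft_add_le {f g : HermiteSeries d} (hf : f ∈ pilipovicDual d)
    (hg : g ∈ pilipovicDual d) (ω : (Fin d → ℝ) × (Fin d → ℝ) → ℝ)
    (z : (Fin d → ℝ) × (Fin d → ℝ)) :
    weightedStft (f + g) ω z ≤ 1 * (weightedStft f ω z + weightedStft g ω z) := by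
  rw [weightedStft, stft_add hf hg, add_mul, one_mul]
  exact enorm_add_le _ _

theorem modulationSpace_add {ω : (Fin d → ℝ) × (Fin d → ℝ) → ℝ} (hω : IsWeight ω) (p q : ℝ≥0∞) :
    ∀ f ∈ (modulationSpace p q ω).carrier, ∀ g ∈ (modulationSpace p q ω).carrier,
      f + g ∈ (modulationSpace p q ω).carrier ∧ (modulationSpace p q ω).gauge (f + g) ≤
        ENNReal.LpAddConst p * ENNReal.LpAddConst q *
          ((modulationSpace p q ω).gauge f + (modulationSpace p q ω).gauge g) := by
  intro f hf g hg
  have h : (modulationSpace p q ω).gauge (f + g) ≤ ENNReal.LpAddConst p * ENNReal.LpAddConst q *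
      ((modulationSpace p q ω).gauge f + (modulationSpace p q ω).gauge g) := by
    simp only [modulationSpace_gauge]
    refine (mixedENorm_le_mul ENNReal.one_ne_top p q (weightedStft_add_le hf.1 hg.1 ω)).trans ?_
    rw [one_mul]
    exact mixedENorm_add_le (aemeasurable_weightedStft hf.1 hω)
      (aemeasurable_weightedStft hg.1 hω) p q
  refine ⟨⟨pilipovicDual_add hf.1 hg.1, h.trans_lt ?_⟩, h⟩
  exact ENNReal.mul_lt_top (ENNReal.mul_lt_top (ENNReal.LpAddConst_lt_top p)
    (ENNReal.LpAddConst_lt_top q)) (ENNReal.add_lt_top.2 ⟨hf.2, hg.2⟩)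

theorem amalgamSpace_add {ω : (Fin d → ℝ) × (Fin d → ℝ) → ℝ} (hω : IsWeight ω) (p q : ℝ≥0∞) :
    ∀ f ∈ (amalgamSpace p q ω).carrier, ∀ g ∈ (amalgamSpace p q ω).carrier,
      f + g ∈ (amalgamSpace p q ω).carrier ∧ (amalgamSpace p q ω).gauge (f + g) ≤
        ENNReal.LpAddConst q * ENNReal.LpAddConst p *
          ((amalgamSpace p q ω).gauge f + (amalgamSpace p q ω).gauge g) := by
  intro f hf g hg
  have h : (amalgamSpace p q ω).gauge (f + g) ≤ ENNReal.LpAddConst q * ENNReal.LpAddConst p *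
      ((amalgamSpace p q ω).gauge f + (amalgamSpace p q ω).gauge g) := by
    simp only [amalgamSpace_gauge]
    refine (mixedENorm_le_mul ENNReal.one_ne_top q p
      fun z => weightedStft_add_le hf.1 hg.1 ω z.swap).trans ?_
    rw [one_mul]
    exact mixedENorm_add_le (aemeasurable_comp_swap (aemeasurable_weightedStft hf.1 hω))
      (aemeasurable_comp_swap (aemeasurable_weightedStft hg.1 hω)) q p
  refine ⟨⟨pilipovicDual_add hf.1 hg.1, h.trans_lt ?_⟩, h⟩
  exact ENNReal.mul_lt_top (ENNReal.mul_lt_top (ENNReal.LpAddConst_lt_top q)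
    (ENNReal.LpAddConst_lt_top p)) (ENNReal.add_lt_top.2 ⟨hf.2, hg.2⟩)

/-! ### Boundedness of the fractional Fourier transform -/

theorem weightedStft_smul_fracFourier (k : ℂ) (ϱ : ℝ) {ω ωϱ : (Fin d → ℝ) × (Fin d → ℝ) → ℝ}
    (hrel : ∀ z, ωϱ z = ω (phaseRotation ϱ z)) (f : HermiteSeries d)
    (z : (Fin d → ℝ) × (Fin d → ℝ)) :
    weightedStft (k • fracFourier ϱ f) ωϱ z = ‖k‖ₑ * weightedStft f ω (phaseRotation ϱ z) := by
  rw [weightedStft, weightedStft, enorm_mul, enorm_mul, hrel, ← mul_assoc]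
  congr 1
  rw [← enorm_mul, ← enorm_norm, norm_stft_smul_fracFourier, ← norm_mul, enorm_norm]

theorem mixedENorm_le_of_blockMap {p q : ℝ≥0∞} (hq : 0 < q) (hqp : q ≤ p) {a b e f : ℝ}
    (he : e ≠ 0) (hdet : a * f - b * e ≠ 0) {F G : (Fin d → ℝ) × (Fin d → ℝ) → ℝ≥0∞}
    (hF : AEMeasurable F) {C : ℝ≥0∞} (hC : C ≠ ∞)
    (h : ∀ z, G z ≤ C * F (blockMap a b e f z)) :
    mixedENorm volume volume q p G ≤
      C * (dilationConst d e q * dilationConst d (b - a * f / e) p) *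
        mixedENorm volume volume p q F := by
  refine (mixedENorm_le_mul hC q p h).trans ?_
  rw [mul_assoc]
  gcongr
  exact mixedENorm_comp_blockMap_le hq hqp he hdet hF

/-- Written with the swap of `x` and `ξ` where amalgam norms occur, all four bounds are the same
estimate from `L^{p,q}` to `L^{q,p}`. They differ only in how the rows and columns of the rotation
matrix are permuted, hence in which entry must not vanish. The scalar `k` lets one proof serve both
`𝓕_ϱ` and the propagator. -/
theorem smul_fracFourier_gaugeBounded (k : ℂ) (ϱ : ℝ) {p q : ℝ≥0∞} (hq : 0 < q) (hqp : q ≤ p)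
    {ω ωϱ : (Fin d → ℝ) × (Fin d → ℝ) → ℝ} (hω : IsWeight ω)
    (hrel : ∀ z, ωϱ z = ω (phaseRotation ϱ z)) :
    (Real.sin (Real.pi * ϱ / 2) ≠ 0 →
      GaugeBounded (fun f => k • fracFourier ϱ f) (modulationSpace p q ω)
        (modulationSpace q p ωϱ) ∧
      GaugeBounded (fun f => k • fracFourier ϱ f) (amalgamSpace q p ω) (amalgamSpace p q ωϱ)) ∧
    (Real.cos (Real.pi * ϱ / 2) ≠ 0 →
      GaugeBounded (fun f => k • fracFourier ϱ f) (modulationSpace p q ω)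
        (amalgamSpace p q ωϱ) ∧
      GaugeBounded (fun f => k • fracFourier ϱ f) (amalgamSpace q p ω)
        (modulationSpace q p ωϱ)) := by
  set s := Real.sin (Real.pi * ϱ / 2) with hs
  set c := Real.cos (Real.pi * ϱ / 2) with hc
  have hcs : c ^ 2 + s ^ 2 = 1 := Real.cos_sq_add_sin_sq _
  have hrot : ∀ z : (Fin d → ℝ) × (Fin d → ℝ), phaseRotation ϱ z = blockMap c (-s) s c z :=
    fun z => by rw [phaseRotation, blockMap, neg_smul, ← sub_eq_add_neg]
  have hswap : ∀ (a b e f : ℝ) (z : (Fin d → ℝ) × (Fin d → ℝ)),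
      blockMap a b e f z.swap = blockMap b a f e z := fun a b e f z => by
    simp [blockMap, add_comm]
  have hswap' : ∀ (a b e f : ℝ) (z : (Fin d → ℝ) × (Fin d → ℝ)),
      (blockMap a b e f z).swap = blockMap e f a b z := fun a b e f z => rfl
  have hfin : ∀ e g : ℝ, ‖k‖ₑ * (dilationConst d e q * dilationConst d g p) ≠ ∞ := fun e g =>
    ENNReal.mul_ne_top enorm_ne_top
      (ENNReal.mul_ne_top (dilationConst_ne_top _ _ _) (dilationConst_ne_top _ _ _))
  have hW := weightedStft_smul_fracFourier k ϱ hrel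
  have hdet1 : c * c - -s * s ≠ 0 := by
    rw [show c * c - -s * s = 1 by rw [← hcs]; ring]; exact one_ne_zero
  have hdet2 : -s * s - c * c ≠ 0 := by
    rw [show -s * s - c * c = -1 by rw [← hcs]; ring]; norm_num
  refine ⟨fun hs0 => ⟨⟨_, hfin s (-s - c * c / s), fun f hf => ?_⟩,
    ⟨_, hfin (-s) (s - c * c / -s), fun f hf => ?_⟩⟩,
    fun hc0 => ⟨⟨_, hfin c (c - -s * s / c), fun f hf => ?_⟩,
    ⟨_, hfin c (c - s * -s / c), fun f hf => ?_⟩⟩⟩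
  · have h : (modulationSpace q p ωϱ).gauge (k • fracFourier ϱ f) ≤
        ‖k‖ₑ * (dilationConst d s q * dilationConst d (-s - c * c / s) p) * (modulationSpace p q ω).gauge f := by
      rw [modulationSpace_gauge, modulationSpace_gauge]
      exact mixedENorm_le_of_blockMap hq hqp hs0 hdet1 (aemeasurable_weightedStft hf.1 hω)
        enorm_ne_top fun z => by rw [hW, hrot]
    exact ⟨⟨smul_fracFourier_mem_pilipovicDual k ϱ hf.1,
      h.trans_lt (ENNReal.mul_lt_top (hfin _ _).lt_top hf.2)⟩, h⟩
  · have h : (amalgamSpace p q ωϱ).gauge (k • fracFourier ϱ f) ≤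
        ‖k‖ₑ * (dilationConst d (-s) q * dilationConst d (s - c * c / -s) p) * (amalgamSpace q p ω).gauge f := by
      rw [amalgamSpace_gauge, amalgamSpace_gauge]
      refine mixedENorm_le_of_blockMap hq hqp (a := c) (b := s) (e := -s) (f := c)
        (neg_ne_zero.2 hs0) (by rwa [mul_neg, ← neg_mul])
        (aemeasurable_comp_swap (aemeasurable_weightedStft hf.1 hω))
        enorm_ne_top fun z => ?_
      rw [hW, hrot, hswap, hswap']
    exact ⟨⟨smul_fracFourier_mem_pilipovicDual k ϱ hf.1,
      h.trans_lt (ENNReal.mul_lt_top (hfin _ _).lt_top hf.2)⟩, h⟩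
  · have h : (amalgamSpace p q ωϱ).gauge (k • fracFourier ϱ f) ≤
        ‖k‖ₑ * (dilationConst d c q * dilationConst d (c - -s * s / c) p) * (modulationSpace p q ω).gauge f := by
      rw [amalgamSpace_gauge, modulationSpace_gauge]
      exact mixedENorm_le_of_blockMap hq hqp hc0 hdet2
        (aemeasurable_weightedStft hf.1 hω) enorm_ne_top fun z => by rw [hW, hrot, hswap]
    exact ⟨⟨smul_fracFourier_mem_pilipovicDual k ϱ hf.1,
      h.trans_lt (ENNReal.mul_lt_top (hfin _ _).lt_top hf.2)⟩, h⟩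
  · have h : (modulationSpace q p ωϱ).gauge (k • fracFourier ϱ f) ≤
        ‖k‖ₑ * (dilationConst d c q * dilationConst d (c - s * -s / c) p) * (amalgamSpace q p ω).gauge f := by
      rw [modulationSpace_gauge, amalgamSpace_gauge]
      refine mixedENorm_le_of_blockMap hq hqp (a := s) (b := c) (e := c) (f := -s) hc0
        (by rwa [mul_neg, ← neg_mul])
        (aemeasurable_comp_swap (aemeasurable_weightedStft hf.1 hω))
        enorm_ne_top fun z => ?_
      rw [hW, hrot, hswap']
    exact ⟨⟨smul_fracFourier_mem_pilipovicDual k ϱ hf.1,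
      h.trans_lt (ENNReal.mul_lt_top (hfin _ _).lt_top hf.2)⟩, h⟩

theorem smul_fracFourier_mapsContinuously_sum (k : ℂ) (ϱ : ℝ) {p q : ℝ≥0∞} (hq : 0 < q)
    (hqp : q ≤ p) {ω ωϱ : (Fin d → ℝ) × (Fin d → ℝ) → ℝ} (hω : IsWeight ω)
    (hrel : ∀ z, ωϱ z = ω (phaseRotation ϱ z)) :
    MapsContinuously (fun f => k • fracFourier ϱ f)
      ((modulationSpace p q ω).sum (amalgamSpace q p ω))
      ((modulationSpace q p ωϱ).sum (amalgamSpace p q ωϱ)) := by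
  obtain ⟨hs, hc⟩ := smul_fracFourier_gaugeBounded k ϱ hq hqp hω hrel
  by_cases h : Real.sin (Real.pi * ϱ / 2) = 0
  · have hc0 : Real.cos (Real.pi * ϱ / 2) ≠ 0 := fun h' => by
      simpa [h, h'] using Real.cos_sq_add_sin_sq (Real.pi * ϱ / 2)
    -- When `sin θ = 0` the modulation and amalgam summands are interchanged, so the target sum is
    -- reordered.
    rw [GaugedSpace.sum_comm (modulationSpace q p ωϱ)]
    exact (hc hc0).1.mapsContinuously_sum_sum (smul_fracFourier_add k ϱ)
      (smul_fracFourier_sub k ϱ) (hc hc0).2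
  · exact (hs h).1.mapsContinuously_sum_sum (smul_fracFourier_add k ϱ)
      (smul_fracFourier_sub k ϱ) (hs h).2

theorem smul_fracFourier_mapsContinuously_inter (k : ℂ) {ϱ : ℝ} (hϱ : ¬ ∃ n : ℤ, ϱ = (n : ℝ))
    {p q : ℝ≥0∞} (hq : 0 < q) (hqp : q ≤ p) {ω ωϱ : (Fin d → ℝ) × (Fin d → ℝ) → ℝ}
    (hω : IsWeight ω) (hωϱ : IsWeight ωϱ) (hrel : ∀ z, ωϱ z = ω (phaseRotation ϱ z)) :
    MapsContinuously (fun f => k • fracFourier ϱ f)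
      ((modulationSpace p q ω).sum (amalgamSpace q p ω))
      ((modulationSpace q p ωϱ).inter (amalgamSpace p q ωϱ)) := by
  -- `sin θ` vanishes at even integers `ϱ` and `cos θ` at odd ones, so excluding `ℤ` makes all four
  -- bounds available.
  have hs0 : Real.sin (Real.pi * ϱ / 2) ≠ 0 := by
    refine sin_fracPhase_ne_zero ?_ ?_
    · rintro ⟨n, hn⟩
      exact hϱ ⟨4 * n, by rw [hn]; push_cast; ring⟩
    · rintro ⟨n, hn⟩
      exact hϱ ⟨2 + 4 * n, by rw [hn]; push_cast; ring⟩
  have hc0 : Real.cos (Real.pi * ϱ / 2) ≠ 0 := by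
    intro h
    obtain ⟨n, hn⟩ := Real.cos_eq_zero_iff.1 h
    refine hϱ ⟨2 * n + 1, ?_⟩
    have := Real.pi_ne_zero
    field_simp at hn
    push_cast
    linarith
  obtain ⟨hs, hc⟩ := smul_fracFourier_gaugeBounded k ϱ hq hqp hω hrel
  exact (hs hs0).1.mapsContinuously_sum_inter (smul_fracFourier_add k ϱ)
    (smul_fracFourier_sub k ϱ) (hc hc0).1 (hc hc0).2 (hs hs0).2
    (ENNReal.mul_ne_top (ENNReal.LpAddConst_lt_top q).ne (ENNReal.LpAddConst_lt_top p).ne)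
    (modulationSpace_add hωϱ q p) (amalgamSpace_add hωϱ p q)

end PilModulation

theorem proposition0p1 (d : ℕ) (ϱ : ℝ) (c : ℂ) (p q : ℝ≥0∞) (hq : 0 < q) (hqp : q ≤ p)
    (ω ωϱ : (Fin d → ℝ) × (Fin d → ℝ) → ℝ) (hω : IsWeight ω) (hωϱ : IsWeight ωϱ)
    (hrel : ∀ z, ωϱ z = ω (phaseRotation ϱ z)) :
    (∀ f : HermiteSeries d,
      oscPropagator (-(Complex.I * ((Real.pi / 4 : ℝ) : ℂ))) (ϱ : ℂ) c f =
        Complex.exp (-(Complex.I * ((Real.pi / 4 : ℝ) : ℂ)) * ((d : ℂ) * (ϱ : ℂ) + c)) •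
          fracFourier ϱ f) ∧
    (MapsContinuously (fracFourier ϱ)
        ((modulationSpace p q ω).sum (amalgamSpace q p ω))
        ((modulationSpace q p ωϱ).sum (amalgamSpace p q ωϱ)) ∧
      MapsContinuously (oscPropagator (-(Complex.I * ((Real.pi / 4 : ℝ) : ℂ))) (ϱ : ℂ) c)
        ((modulationSpace p q ω).sum (amalgamSpace q p ω))
        ((modulationSpace q p ωϱ).sum (amalgamSpace p q ωϱ))) ∧
    ((¬ ∃ k : ℤ, ϱ = (k : ℝ)) →
      MapsContinuously (fracFourier ϱ)
          ((modulationSpace p q ω).sum (amalgamSpace q p ω))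
          ((modulationSpace q p ωϱ).inter (amalgamSpace p q ωϱ)) ∧
        MapsContinuously (oscPropagator (-(Complex.I * ((Real.pi / 4 : ℝ) : ℂ))) (ϱ : ℂ) c)
          ((modulationSpace p q ω).sum (amalgamSpace q p ω))
          ((modulationSpace q p ωϱ).inter (amalgamSpace p q ωϱ))) := by

  have hosc : oscPropagator (-(Complex.I * ((Real.pi / 4 : ℝ) : ℂ))) (ϱ : ℂ) c =
      fun f : HermiteSeries d => _ • fracFourier ϱ f :=
    funext (oscPropagator_eq_smul_fracFourier ϱ c)
  have hone : fracFourier ϱ = fun f : HermiteSeries d => (1 : ℂ) • fracFourier ϱ f := by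
    simp only [one_smul]
  refine ⟨oscPropagator_eq_smul_fracFourier ϱ c, ⟨?_, ?_⟩, fun hϱ => ⟨?_, ?_⟩⟩
  · rw [hone]
    exact smul_fracFourier_mapsContinuously_sum 1 ϱ hq hqp hω hrel
  · rw [hosc]
    exact smul_fracFourier_mapsContinuously_sum _ ϱ hq hqp hω hrel
  · rw [hone]
    exact smul_fracFourier_mapsContinuously_inter 1 hϱ hq hqp hω hωϱ hrel
  · rw [hosc]
    exact smul_fracFourier_mapsContinuously_inter _ hϱ hq hqp hω hωϱ hrel
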